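/- A real symmetric matrix $A$ is *copositive* if $x^TAx\ge 0$ for every entrywise nonnegative real vector $x$, and it is *SPN* if it is the sum of a real symmetric positive semidefinite matrix and a symmetric entrywise nonnegative matrix. For a finite simple graph $G$, a real symmetric matrix $A$ with rows and columns indexed by the vertices of $G$ *has graph $G$* if, for all vertices $i\ne j$, $ij$ is an edge of $G$ if and only if $a_{ij}\ne 0$ (the diagonal entries of $A$ are unrestricted). The graph $G$ is an *SPN graph* if every copositive matrix with graph $G$ is SPN. The *fan* $F_5$ is the graph on $5$ vertices that consists of a path of length $3$ (on $4$ vertices) and an additional vertex adjacent to all four vertices of the path. **Theorem.** A simple graph on $5$ vertices is an SPN graph if and only if it does not contain $F_5$ as a (not necessarily induced) subgraph, i.e. it has no subgraph isomorphic to $F_5$. -/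

import Mathlib

open scoped Matrix

/-- A real symmetric matrix `A` is copositive if `xᵀ A x ≥ 0` for every entrywise nonnegative
vector `x`. -/
def CopositiveMatrix {V : Type*} [Fintype V] (A : Matrix V V ℝ) : Prop :=
  A.IsSymm ∧ ∀ x : V → ℝ, (∀ i, 0 ≤ x i) → 0 ≤ x ⬝ᵥ (A *ᵥ x)

/-- A matrix is SPN if it is the sum of a real (symmetric) positive semidefinite matrix and a
symmetric entrywise nonnegative matrix. -/
def SPNMatrix {V : Type*} (A : Matrix V V ℝ) : Prop :=
  ∃ P N : Matrix V V ℝ, P.PosSemidef ∧ N.IsSymm ∧ (∀ i j, 0 ≤ N i j) ∧ A = P + N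

/-- The graph of a symmetric matrix: distinct `i`, `j` are adjacent iff `A i j ≠ 0`. -/
def matrixGraph {V : Type*} (A : Matrix V V ℝ) : SimpleGraph V :=
  SimpleGraph.fromRel (fun i j => A i j ≠ 0)

/-- On symmetric matrices the symmetrization built into `SimpleGraph.fromRel` is harmless. -/
theorem matrixGraph_adj {V : Type*} {A : Matrix V V ℝ} (hA : A.IsSymm) (i j : V) :
    (matrixGraph A).Adj i j ↔ i ≠ j ∧ A i j ≠ 0 := by
  simp only [matrixGraph, SimpleGraph.fromRel_adj, hA.apply i j, or_self]

/-- A graph is SPN if every copositive matrix whose graph is `G` is an SPN matrix. -/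
def SPNGraph {V : Type*} [Fintype V] (G : SimpleGraph V) : Prop :=
  ∀ A : Matrix V V ℝ, CopositiveMatrix A → matrixGraph A = G → SPNMatrix A

/-- The fan on five vertices: the path `0 - 1 - 3 - 4` and the vertex `2` joined to each of its
four vertices. -/
def fanF5 : SimpleGraph (Fin 5) :=
  SimpleGraph.fromEdgeSet
    {s(0, 1), s(1, 3), s(3, 4), s(2, 0), s(2, 1), s(2, 3), s(2, 4)}

/-! Failure of the SPN property on a supergraph of the fan comes from one explicit matrix.
`fanMatrix` is copositive with three nonnegative zeros; in any decomposition `P + N` these force `N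
0 4 < 0`. Missing edges of the larger graph are filled in with small positive entries, which is
harmless because the SPN cone is closed (`spn_of_forall_add_smul`).

For the converse, a small multiple of the identity makes the matrix strictly copositive without
changing its graph. The complement of the fan is a path of length three plus an isolated vertex, so
if the graph has no fan, its complement contains a star with three leaves, a triangle, a path of
length two with a disjoint edge, or a 4-cycle (`exists_fan_labeling`). Each case is handled by the
same tools.

SPN matrices are closed under raising entries, so it is enough to lower a nonnegative entry and
prove the result SPN. Lowering either reaches zero or produces a zero `u` of the form
(`StrictlyCopositive.sub_edgeMatrix_or_exists_zero`). On the support of `u` the matrix is positive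
semidefinite, and a copositive matrix that is positive semidefinite off one coordinate is SPN
(`CopositiveMatrix.spn_of_form_nonneg`). This gives Diananda's theorem up to order four, and in
order five it disposes of every row whose off-diagonal entries have one sign. In each of the four
cases some vertex has at most two neighbours: its row has mixed signs, and lowering the positive
entry gives a zero supported exactly on a triangle (`StrictlyCopositive.exists_triangle_zero`). -/

/-- Strict copositivity: the quadratic form is positive on nonzero nonnegative vectors. -/
def StrictlyCopositive {V : Type*} [Fintype V] (A : Matrix V V ℝ) : Prop :=
  A.IsSymm ∧ ∀ x : V → ℝ, (∀ i, 0 ≤ x i) → x ≠ 0 → 0 < x ⬝ᵥ (A *ᵥ x)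

/-! ### Monotonicity and quadratic form identities. -/

section Basic
variable {V : Type*} {A B : Matrix V V ℝ}

theorem isSymm_of_posSemidef (h : A.PosSemidef) : A.IsSymm := by
  have := h.isHermitian
  rwa [Matrix.IsHermitian, Matrix.conjTranspose_eq_transpose_of_trivial] at this

/-- The increase is absorbed by the nonnegative summand. Hence entries may always be lowered before
proving SPN. -/
theorem SPNMatrix.mono (hA : SPNMatrix A) (hs : A.IsSymm) (hB : B.IsSymm)
    (h : ∀ i j, A i j ≤ B i j) : SPNMatrix B := by
  obtain ⟨P, N, hP, hN, hN0, rfl⟩ := hA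
  refine ⟨P, N + (B - (P + N)), hP, hN.add (hB.sub hs), fun i j => ?_, by abel⟩
  have := h i j
  have := hN0 i j
  simp only [Matrix.add_apply, Matrix.sub_apply] at *
  linarith

theorem SPNMatrix.submatrix {W : Type*} (hA : SPNMatrix A) (f : W → V) :
    SPNMatrix (A.submatrix f f) := by
  obtain ⟨P, N, hP, hN, hN0, rfl⟩ := hA
  exact ⟨P.submatrix f f, N.submatrix f f, hP.submatrix f, hN.submatrix f,
    fun i j => hN0 _ _, rfl⟩

theorem add_single_nonneg [DecidableEq V] {u : V → ℝ} (hu : ∀ i, 0 ≤ u i) {j : V} {s : ℝ}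
    (hs : 0 ≤ u j + s) (i : V) : 0 ≤ (u + Pi.single j s : V → ℝ) i := by
  by_cases h : i = j
  · subst h; simpa using hs
  · simpa [h] using hu i

end Basic

section Forms
variable {V : Type*} [Fintype V] {A B : Matrix V V ℝ}

theorem StrictlyCopositive.copositive (h : StrictlyCopositive A) : CopositiveMatrix A := by
  refine ⟨h.1, fun x hx => ?_⟩
  by_cases h0 : x = 0
  · simp [h0]
  · exact (h.2 x hx h0).le

theorem dotProduct_mulVec_comm (hA : A.IsSymm) (x y : V → ℝ) :
    x ⬝ᵥ (A *ᵥ y) = y ⬝ᵥ (A *ᵥ x) := by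
  rw [Matrix.dotProduct_mulVec, ← Matrix.mulVec_transpose, hA.eq, dotProduct_comm]

theorem form_add (hA : A.IsSymm) (x y : V → ℝ) :
    (x + y) ⬝ᵥ (A *ᵥ (x + y)) = x ⬝ᵥ (A *ᵥ x) + 2 * (x ⬝ᵥ (A *ᵥ y)) + y ⬝ᵥ (A *ᵥ y) := by
  rw [Matrix.mulVec_add, add_dotProduct, dotProduct_add, dotProduct_add,
    dotProduct_mulVec_comm hA y x]
  ring

theorem form_smul (c : ℝ) (x : V → ℝ) :
    (c • x) ⬝ᵥ (A *ᵥ (c • x)) = c ^ 2 * (x ⬝ᵥ (A *ᵥ x)) := by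
  rw [Matrix.mulVec_smul, smul_dotProduct, dotProduct_smul, smul_eq_mul, smul_eq_mul]
  ring

theorem form_mono (h : ∀ i j, A i j ≤ B i j) {x : V → ℝ} (hx : ∀ i, 0 ≤ x i) :
    x ⬝ᵥ (A *ᵥ x) ≤ x ⬝ᵥ (B *ᵥ x) := by
  refine Finset.sum_le_sum fun i _ => mul_le_mul_of_nonneg_left ?_ (hx i)
  exact Finset.sum_le_sum fun j _ => mul_le_mul_of_nonneg_right (h i j) (hx j)

theorem posSemidef_of_form_nonneg (hA : A.IsSymm) (h : ∀ x : V → ℝ, 0 ≤ x ⬝ᵥ (A *ᵥ x)) :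
    A.PosSemidef := by
  refine Matrix.PosSemidef.of_dotProduct_mulVec_nonneg ?_ ?_
  · rw [Matrix.IsHermitian, Matrix.conjTranspose_eq_transpose_of_trivial, hA.eq]
  · simpa using h

theorem form_nonneg_of_posSemidef (h : A.PosSemidef) (x : V → ℝ) : 0 ≤ x ⬝ᵥ (A *ᵥ x) := by
  simpa using h.dotProduct_mulVec_nonneg x

theorem CopositiveMatrix.mono (hA : CopositiveMatrix A) (hB : B.IsSymm)
    (h : ∀ i j, A i j ≤ B i j) : CopositiveMatrix B :=
  ⟨hB, fun x hx => (hA.2 x hx).trans (form_mono h hx)⟩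

theorem spn_of_form_nonneg (hA : A.IsSymm) (h : ∀ x : V → ℝ, 0 ≤ x ⬝ᵥ (A *ᵥ x)) :
    SPNMatrix A :=
  ⟨A, 0, posSemidef_of_form_nonneg hA h, Matrix.isSymm_zero, by simp, by simp⟩

theorem SPNMatrix.transpose_mul_mul {W : Type*} [Fintype W] (hA : SPNMatrix A) {C : Matrix V W ℝ}
    (hC : ∀ i j, 0 ≤ C i j) : SPNMatrix (Cᵀ * A * C) := by
  obtain ⟨P, N, hP, hN, hN0, rfl⟩ := hA
  refine ⟨Cᵀ * P * C, Cᵀ * N * C, ?_, ?_, ?_, by rw [Matrix.mul_add, Matrix.add_mul]⟩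
  · have := hP.conjTranspose_mul_mul_same C
    rwa [Matrix.conjTranspose_eq_transpose_of_trivial] at this
  · rw [Matrix.IsSymm, Matrix.transpose_mul, Matrix.transpose_mul, Matrix.transpose_transpose,
      hN.eq, Matrix.mul_assoc]
  · intro i j
    exact Finset.sum_nonneg fun k _ => mul_nonneg
      (Finset.sum_nonneg fun l _ => mul_nonneg (hC _ _) (hN0 _ _)) (hC _ _)

theorem form_submatrix_equiv {W : Type*} [Fintype W] (f : W ≃ V) (x : W → ℝ) :
    x ⬝ᵥ (A.submatrix f f *ᵥ x) = (x ∘ f.symm) ⬝ᵥ (A *ᵥ (x ∘ f.symm)) := by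
  rw [Matrix.submatrix_mulVec_equiv, comp_equiv_symm_dotProduct]

end Forms

/-! ### First-order conditions at zeros and minimizers. -/

section Zeros
variable {V : Type*} [Fintype V] {A : Matrix V V ℝ}

theorem form_add_single [DecidableEq V] (hA : A.IsSymm) (u : V → ℝ) (j : V) (s : ℝ) :
    (u + Pi.single j s) ⬝ᵥ (A *ᵥ (u + Pi.single j s)) =
      u ⬝ᵥ (A *ᵥ u) + 2 * s * (A *ᵥ u) j + s ^ 2 * A j j := by
  rw [form_add hA, dotProduct_mulVec_comm hA u (Pi.single j s), single_dotProduct, single_dotProduct,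
    Matrix.mulVec_single]
  simp
  ring

/-- A quadratic polynomial with vanishing constant term that is nonnegative on `[0, ∞)` has
nonnegative linear coefficient. -/
theorem nonneg_of_forall_linear_add_sq {b c r : ℝ} (hr : 0 < r)
    (h : ∀ s : ℝ, 0 ≤ s → s ≤ r → 0 ≤ 2 * s * b + s ^ 2 * c) : 0 ≤ b := by
  by_contra! hb
  have hc : 0 < |c| + 1 := by positivity
  set s := min r (-b / (|c| + 1)) with hs
  have hs0 : 0 < s := lt_min hr (div_pos (by linarith) hc)
  have h1 := h s hs0.le (min_le_left _ _)
  have h2 : s * (|c| + 1) ≤ -b := by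
    rw [← le_div_iff₀ hc]; exact min_le_right _ _
  have h3 : s ^ 2 * c ≤ s * (s * (|c| + 1)) := by
    nlinarith [le_abs_self c, sq_nonneg s]
  nlinarith

theorem minimizer_mulVec_nonneg [DecidableEq V] (hA : A.IsSymm) {u : V → ℝ} {j : V}
    (h : ∀ s : ℝ, 0 ≤ s → u ⬝ᵥ (A *ᵥ u) ≤
      (u + Pi.single j s) ⬝ᵥ (A *ᵥ (u + Pi.single j s))) : 0 ≤ (A *ᵥ u) j := by
  refine nonneg_of_forall_linear_add_sq one_pos (c := A j j) fun s hs _ => ?_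
  have := h s hs
  rw [form_add_single hA] at this
  linarith

theorem minimizer_mulVec_eq_zero [DecidableEq V] (hA : A.IsSymm) {u : V → ℝ} {j : V}
    (hj : 0 < u j)
    (h : ∀ s : ℝ, 0 ≤ u j + s → u ⬝ᵥ (A *ᵥ u) ≤
      (u + Pi.single j s) ⬝ᵥ (A *ᵥ (u + Pi.single j s))) : (A *ᵥ u) j = 0 := by
  refine le_antisymm ?_ (minimizer_mulVec_nonneg hA fun s hs => h s (by linarith))
  have : 0 ≤ -(A *ᵥ u) j := by
    refine nonneg_of_forall_linear_add_sq hj (c := A j j) fun s hs hsu => ?_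
    have := h (-s) (by linarith)
    rw [form_add_single hA] at this
    linarith
  linarith

theorem CopositiveMatrix.mulVec_zero_nonneg (hA : CopositiveMatrix A) {u : V → ℝ}
    (hu : ∀ i, 0 ≤ u i) (h0 : u ⬝ᵥ (A *ᵥ u) = 0) (j : V) : 0 ≤ (A *ᵥ u) j := by
  classical
  refine minimizer_mulVec_nonneg hA.1 fun s hs => ?_
  rw [h0]
  exact hA.2 _ (add_single_nonneg hu (add_nonneg (hu j) hs))

theorem CopositiveMatrix.mulVec_zero_eq_zero (hA : CopositiveMatrix A) {u : V → ℝ}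
    (hu : ∀ i, 0 ≤ u i) (h0 : u ⬝ᵥ (A *ᵥ u) = 0) {j : V} (hj : 0 < u j) : (A *ᵥ u) j = 0 := by
  classical
  refine minimizer_mulVec_eq_zero hA.1 hj fun s hs => ?_
  rw [h0]
  exact hA.2 _ (add_single_nonneg hu hs)

/-- A copositive form is nonnegative on all vectors supported in the support of one of its
zeros. -/
theorem CopositiveMatrix.form_nonneg_of_support (hA : CopositiveMatrix A) {u : V → ℝ}
    (hu : ∀ i, 0 ≤ u i) (h0 : u ⬝ᵥ (A *ᵥ u) = 0) {x : V → ℝ} (hx : ∀ i, u i = 0 → x i = 0) :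
    0 ≤ x ⬝ᵥ (A *ᵥ x) := by
  -- `M` is large enough that `x + M • u` is nonnegative. Since `A *ᵥ u` vanishes on the support of
  -- `u`, adding `M • u` does not change the form.
  set M := ∑ i, |x i| / u i with hM
  have hM0 : ∀ i ∈ Finset.univ, 0 ≤ |x i| / u i := fun i _ => div_nonneg (abs_nonneg _) (hu i)
  have hcross : x ⬝ᵥ (A *ᵥ u) = 0 := by
    refine Finset.sum_eq_zero fun i _ => ?_
    rcases (hu i).eq_or_lt with h | h
    · rw [hx i h.symm, zero_mul]
    · rw [hA.mulVec_zero_eq_zero hu h0 h, mul_zero]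
  have h := hA.2 (x + M • u) fun i => ?_
  · rwa [form_add hA.1, form_smul, h0, Matrix.mulVec_smul, dotProduct_smul, hcross, smul_zero,
      mul_zero, mul_zero, add_zero, add_zero] at h
  · rcases (hu i).eq_or_lt with h | h
    · simp [← h, hx i h.symm]
    · have h1 : |x i| / u i ≤ M := Finset.single_le_sum hM0 (Finset.mem_univ i)
      rw [div_le_iff₀ h] at h1
      have := neg_abs_le (x i)
      simp only [Pi.add_apply, Pi.smul_apply, smul_eq_mul]
      linarith

end Zeros

/-! ### Closedness of the SPN cone. -/

section Closure
variable {V : Type*} [Fintype V] {A : Matrix V V ℝ}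

/-- Test the form on `e_i ± e_j`. This supplies the compactness needed for limits. -/
theorem abs_apply_le_of_posSemidef [DecidableEq V] {P : Matrix V V ℝ} (hP : P.PosSemidef) {C : ℝ}
    (hC : ∀ i, P i i ≤ C) (i j : V) : |P i j| ≤ C := by
  have hs := isSymm_of_posSemidef hP
  have h1 := form_nonneg_of_posSemidef hP (Pi.single i 1 + Pi.single j 1)
  have h2 := form_nonneg_of_posSemidef hP (Pi.single i 1 + Pi.single j (-1))
  rw [form_add_single hs] at h1 h2
  simp only [Matrix.mulVec_single, single_dotProduct, Matrix.col_apply, MulOpposite.op_one,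
    one_smul, one_mul, mul_one] at h1 h2
  rw [hs.apply i j] at h1 h2
  have := hC i
  have := hC j
  rw [abs_le]
  constructor <;> linarith

/-- The SPN matrices form a closed cone: it suffices to check small perturbations. -/
theorem spn_of_forall_add_smul (hA : A.IsSymm) {D : Matrix V V ℝ}
    (h : ∀ ε : ℝ, 0 < ε → SPNMatrix (A + ε • D)) : SPNMatrix A := by
  classical
  -- The nonnegative summand is kept only as an entrywise inequality, which survives the limit; only
  -- the semidefinite summands need a convergent subsequence.
  have h' : ∀ n : ℕ, ∃ P : Matrix V V ℝ, P.PosSemidef ∧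
      ∀ i j, P i j ≤ A i j + (1 / ((n : ℝ) + 1)) * D i j := by
    intro n
    obtain ⟨P, N, hP, -, hN, he⟩ := h (1 / ((n : ℝ) + 1)) (by positivity)
    refine ⟨P, hP, fun i j => ?_⟩
    have h1 := congrFun (congrFun he i) j
    have h2 := hN i j
    simp only [Matrix.add_apply, Matrix.smul_apply, smul_eq_mul] at h1
    linarith
  choose P hP hle using h'
  set C := ∑ i, (|A i i| + |D i i|) with hC
  have hdiag : ∀ n i, P n i i ≤ C := by
    intro n i
    have h1 : |A i i| + |D i i| ≤ C :=
      Finset.single_le_sum (f := fun i => |A i i| + |D i i|) (fun i _ => by positivity)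
        (Finset.mem_univ i)
    have h2 : (1 / ((n : ℝ) + 1)) * D i i ≤ |D i i| := by
      refine (le_abs_self _).trans ?_
      rw [abs_mul]
      refine mul_le_of_le_one_left (abs_nonneg _) ?_
      rw [abs_of_nonneg (by positivity), div_le_one (by positivity)]
      have : (0 : ℝ) ≤ n := Nat.cast_nonneg n
      linarith
    have := hle n i i
    have := le_abs_self (A i i)
    linarith
  have hK : IsCompact (Set.univ.pi fun _ : V => Set.univ.pi fun _ : V => Set.Icc (-C) C) :=
    isCompact_univ_pi fun _ => isCompact_univ_pi fun _ => isCompact_Icc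
  obtain ⟨Q, -, φ, hφ, hlim⟩ := hK.tendsto_subseq (x := fun n i j => P n i j) fun n i _ j _ =>
    abs_le.1 (abs_apply_le_of_posSemidef (hP n) (hdiag n) i j)
  have hlim' : ∀ i j, Filter.Tendsto (fun n => P (φ n) i j) Filter.atTop (nhds (Q i j)) :=
    fun i j => tendsto_pi_nhds.1 (tendsto_pi_nhds.1 hlim i) j
  have hQs : Matrix.IsSymm (Matrix.of Q) := by
    ext i j
    refine tendsto_nhds_unique (hlim' j i) ?_
    have h1 := hlim' i j
    simp only [← (isSymm_of_posSemidef (hP _)).apply i j] at h1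
    exact h1
  refine SPNMatrix.mono (spn_of_form_nonneg hQs fun x => ?_) hQs hA fun i j => ?_
  · refine ge_of_tendsto' (x := Filter.atTop)
      (f := fun n => x ⬝ᵥ (P (φ n) *ᵥ x)) ?_ fun n => form_nonneg_of_posSemidef (hP _) x
    exact tendsto_finsetSum _ fun i _ => (tendsto_finsetSum _ fun j _ =>
      (hlim' i j).mul_const _).const_mul _
  · have h1 : Filter.Tendsto (fun n : ℕ => A i j + (1 / ((n : ℝ) + 1)) * D i j) Filter.atTop
        (nhds (A i j + 0 * D i j)) :=
      (tendsto_one_div_add_atTop_nhds_zero_nat.mul_const _).const_add _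
    have h2 := le_of_tendsto_of_tendsto' (hlim' i j) (h1.comp hφ.tendsto_atTop)
      fun n => hle (φ n) i j
    simpa using h2

theorem form_add_smul_one [DecidableEq V] (ε : ℝ) (x : V → ℝ) :
    x ⬝ᵥ ((A + ε • (1 : Matrix V V ℝ)) *ᵥ x) = x ⬝ᵥ (A *ᵥ x) + ε * (x ⬝ᵥ x) := by
  rw [Matrix.add_mulVec, dotProduct_add, Matrix.smul_mulVec, Matrix.one_mulVec, dotProduct_smul,
    smul_eq_mul]

theorem CopositiveMatrix.add_smul_one [DecidableEq V] (hA : CopositiveMatrix A) {ε : ℝ}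
    (hε : 0 < ε) : StrictlyCopositive (A + ε • (1 : Matrix V V ℝ)) := by
  refine ⟨hA.1.add (Matrix.isSymm_one.smul _), fun x hx hx0 => ?_⟩
  rw [form_add_smul_one]
  have h1 := hA.2 x hx
  have h2 : 0 < x ⬝ᵥ x := by
    refine lt_of_le_of_ne (Finset.sum_nonneg fun i _ => mul_self_nonneg (x i)) fun h => hx0 ?_
    exact dotProduct_self_eq_zero.1 h.symm
  nlinarith

theorem spn_of_strictlyCopositive_add [DecidableEq V] (hA : CopositiveMatrix A)
    (h : ∀ ε : ℝ, 0 < ε → StrictlyCopositive (A + ε • (1 : Matrix V V ℝ)) →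
      SPNMatrix (A + ε • (1 : Matrix V V ℝ))) : SPNMatrix A :=
  spn_of_forall_add_smul hA.1 fun ε hε => h ε hε (hA.add_smul_one hε)

end Closure

/-! ### Copositive matrices that are positive semidefinite off one coordinate. -/

section Kernel
variable {V : Type*} [Fintype V] {A : Matrix V V ℝ}

theorem continuous_form : Continuous fun x : V → ℝ => x ⬝ᵥ (A *ᵥ x) := by
  unfold dotProduct Matrix.mulVec dotProduct
  fun_prop

/-- If `y` is a vector with nonnegative form annihilated by `A` off the coordinate `v`, where
`y v = 1`, then `A` is positive semidefinite as soon as it is so off `v`. -/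
theorem form_nonneg_of_mulVec_eq_zero (hA : A.IsSymm) {v : V} {y : V → ℝ} (hy : y v ≠ 0)
    (h0 : ∀ j, j ≠ v → (A *ᵥ y) j = 0) (hyy : 0 ≤ y ⬝ᵥ (A *ᵥ y))
    (h : ∀ x : V → ℝ, x v = 0 → 0 ≤ x ⬝ᵥ (A *ᵥ x)) (x : V → ℝ) : 0 ≤ x ⬝ᵥ (A *ᵥ x) := by
  -- Clearing coordinate `v` along `y` costs no cross term, because `A *ᵥ y` is supported at `v`.
  set z := x - (x v / y v) • y with hz
  have hzv : z v = 0 := by simp [hz, div_mul_cancel₀ _ hy]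
  have hx : x = z + (x v / y v) • y := by simp [hz]
  have hcross : z ⬝ᵥ (A *ᵥ y) = 0 := by
    refine Finset.sum_eq_zero fun i _ => ?_
    by_cases hi : i = v
    · rw [hi, hzv, zero_mul]
    · rw [h0 i hi, mul_zero]
  rw [hx, form_add hA, form_smul, Matrix.mulVec_smul, dotProduct_smul, hcross, smul_zero,
    mul_zero, add_zero]
  exact add_nonneg (h z hzv) (mul_nonneg (sq_nonneg _) hyy)

/-- Minimize the form of `B` over `y ≥ 0`, `y v = 1`. The first-order conditions say that `l`, the
part of `B *ᵥ y` off `v`, is nonnegative and orthogonal to `y`. Subtracting `N = l eᵀ + e lᵀ` makes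
`(B - N) *ᵥ y` vanish off `v`, so `B - N` is positive semidefinite. The shift by `ε` is what makes
the minimum exist. -/
theorem spn_of_strictlyCopositive_of_form_nonneg [DecidableEq V] {ε : ℝ} (hε : 0 < ε)
    (hA : CopositiveMatrix A) {v : V} (h : ∀ x : V → ℝ, x v = 0 → 0 ≤ x ⬝ᵥ (A *ᵥ x)) :
    SPNMatrix (A + ε • (1 : Matrix V V ℝ)) := by
  set B := A + ε • (1 : Matrix V V ℝ) with hB
  have hBs : B.IsSymm := (hA.add_smul_one hε).1
  have hBc : CopositiveMatrix B := (hA.add_smul_one hε).copositive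
  set S : Set (V → ℝ) := {y | (∀ i, 0 ≤ y i) ∧ y v = 1} with hS
  have hScl : IsClosed S := by
    refine IsClosed.inter ?_ (isClosed_eq (continuous_apply v) continuous_const)
    exact isClosed_Ici (a := (0 : V → ℝ))
  have hy0 : Pi.single v 1 ∈ S := by
    refine ⟨fun i => ?_, by simp⟩
    by_cases hi : i = v
    · subst hi; simp
    · simp [hi]
  obtain ⟨y, hyS, hmin⟩ : ∃ y ∈ S, ∀ z ∈ S, y ⬝ᵥ (B *ᵥ y) ≤ z ⬝ᵥ (B *ᵥ z) := by
    set c := Pi.single v 1 ⬝ᵥ (B *ᵥ Pi.single v 1) with hc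
    -- On the sublevel set `ε * z i ^ 2 ≤ c`; the `+ 1` turns this into a bound on `z i` itself.
    set R := c / ε + 1 with hR
    have hbig : ∀ z ∈ S, z ⬝ᵥ (B *ᵥ z) ≤ c → ∀ i, z i ≤ R := by
      intro z hz hzc i
      rw [hB, form_add_smul_one] at hzc
      have h1 : ε * (z ⬝ᵥ z) ≤ c := by linarith [hA.2 z hz.1]
      rw [mul_comm, ← le_div_iff₀ hε] at h1
      have h2 : z i * z i ≤ z ⬝ᵥ z := Finset.single_le_sum (f := fun i => z i * z i)
        (fun i _ => mul_self_nonneg _) (Finset.mem_univ i)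
      nlinarith [sq_nonneg (z i - 1)]
    have hK : IsCompact (S ∩ {z | z ⬝ᵥ (B *ᵥ z) ≤ c}) := by
      refine IsCompact.of_isClosed_subset
        (isCompact_univ_pi fun _ : V => isCompact_Icc (a := (0 : ℝ)) (b := R))
        (hScl.inter (isClosed_le continuous_form continuous_const)) ?_
      rintro z ⟨hz, hzc⟩ i -
      exact ⟨hz.1 i, hbig z hz hzc i⟩
    obtain ⟨y, hy, hm⟩ := hK.exists_isMinOn ⟨_, hy0, le_refl c⟩
      (continuous_form (A := B)).continuousOn
    refine ⟨y, hy.1, fun z hz => ?_⟩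
    by_cases hzc : z ⬝ᵥ (B *ᵥ z) ≤ c
    · exact hm ⟨hz, hzc⟩
    · exact le_trans hy.2 (not_le.1 hzc).le
  have hshift : ∀ j, j ≠ v → ∀ s : ℝ, 0 ≤ y j + s → y ⬝ᵥ (B *ᵥ y) ≤
      (y + Pi.single j s) ⬝ᵥ (B *ᵥ (y + Pi.single j s)) := fun j hj s hs =>
    hmin _ ⟨add_single_nonneg hyS.1 hs, by simp [hj.symm, hyS.2]⟩
  have hl0 : ∀ j, j ≠ v → 0 ≤ (B *ᵥ y) j := fun j hj =>
    minimizer_mulVec_nonneg hBs fun s hs => hshift j hj s (add_nonneg (hyS.1 j) hs)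
  have hl1 : ∀ j, j ≠ v → y j * (B *ᵥ y) j = 0 := by
    intro j hj
    rcases (hyS.1 j).eq_or_lt with h1 | h1
    · rw [← h1, zero_mul]
    · rw [minimizer_mulVec_eq_zero hBs h1 (hshift j hj), mul_zero]
  set l : V → ℝ := fun j => if j = v then 0 else (B *ᵥ y) j with hl
  have hlv : l v = 0 := by simp [hl]
  have hlj : ∀ j, 0 ≤ l j := by
    intro j
    by_cases hj : j = v
    · simp [hl, hj]
    · simpa [hl, hj] using hl0 j hj
  have hly : l ⬝ᵥ y = 0 := by
    refine Finset.sum_eq_zero fun j _ => ?_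
    by_cases hj : j = v
    · simp [hl, hj]
    · simpa [hl, hj, mul_comm] using hl1 j hj
  set e : V → ℝ := Pi.single v 1 with he
  set N : Matrix V V ℝ := Matrix.vecMulVec l e + Matrix.vecMulVec e l with hN
  have hNs : N.IsSymm := by
    rw [Matrix.IsSymm, hN, Matrix.transpose_add, Matrix.transpose_vecMulVec,
      Matrix.transpose_vecMulVec, add_comm]
  have he0 : ∀ i, 0 ≤ e i := hy0.1
  have hN0 : ∀ i j, 0 ≤ N i j := fun i j => by
    simpa [hN, Matrix.vecMulVec_apply] using
      add_nonneg (mul_nonneg (hlj i) (he0 j)) (mul_nonneg (he0 i) (hlj j))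
  have hNx : ∀ x, N *ᵥ x = x v • l + (l ⬝ᵥ x) • e := by
    intro x
    rw [hN, Matrix.add_mulVec, Matrix.vecMulVec_mulVec, Matrix.vecMulVec_mulVec]
    simp [he]
  refine SPNMatrix.mono (A := B - N) (spn_of_form_nonneg (hBs.sub hNs) ?_) (hBs.sub hNs) hBs ?_
  · refine form_nonneg_of_mulVec_eq_zero (hBs.sub hNs) (v := v) (y := y) (by simp [hyS.2])
      ?_ ?_ ?_
    · intro j hj
      rw [Matrix.sub_mulVec, hNx, hyS.2, hly]
      simp [hl, hj]
    · rw [Matrix.sub_mulVec, hNx, hyS.2, hly, dotProduct_sub]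
      simp [dotProduct_comm y l, hly, hBc.2 y hyS.1]
    · intro x hx
      rw [Matrix.sub_mulVec, hNx, hx, dotProduct_sub, hB, form_add_smul_one]
      have h1 : 0 ≤ x ⬝ᵥ x := Finset.sum_nonneg fun i _ => mul_self_nonneg (x i)
      have h2 := h x hx
      simp only [zero_smul, zero_add, dotProduct_smul, he, dotProduct_single, hx, smul_eq_mul,
        zero_mul, mul_zero, sub_zero]
      positivity
  · intro i j
    simpa using hN0 i j

/-- A copositive matrix that is positive semidefinite off one coordinate is SPN. -/
theorem CopositiveMatrix.spn_of_form_nonneg (hA : CopositiveMatrix A) (v : V)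
    (h : ∀ x : V → ℝ, x v = 0 → 0 ≤ x ⬝ᵥ (A *ᵥ x)) : SPNMatrix A := by
  classical
  exact spn_of_forall_add_smul hA.1 fun ε hε =>
    spn_of_strictlyCopositive_of_form_nonneg hε hA h

theorem CopositiveMatrix.spn_of_zero (hA : CopositiveMatrix A) {u : V → ℝ} (hu : ∀ i, 0 ≤ u i)
    (h0 : u ⬝ᵥ (A *ᵥ u) = 0) (v : V) (hv : ∀ i, i ≠ v → u i ≠ 0) : SPNMatrix A :=
  hA.spn_of_form_nonneg v fun x hx => hA.form_nonneg_of_support hu h0 fun i hi => by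
    by_contra hxi
    exact hv i (fun h => hxi (h ▸ hx)) hi

end Kernel

/-! ### Lowering one off-diagonal entry. -/

section EdgeMatrix
variable {V : Type*} [DecidableEq V]

/-- The symmetric matrix with entries `1` at the positions `(i, j)` and `(j, i)`. -/
def edgeMatrix (i j : V) : Matrix V V ℝ := Matrix.single i j 1 + Matrix.single j i 1

theorem edgeMatrix_isSymm (i j : V) : (edgeMatrix i j).IsSymm := by
  rw [Matrix.IsSymm, edgeMatrix, Matrix.transpose_add, Matrix.transpose_single,
    Matrix.transpose_single, add_comm]

theorem edgeMatrix_self_left {i j : V} (h : i ≠ j) : edgeMatrix i j i j = 1 := by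
  simp [edgeMatrix, h.symm]

theorem edgeMatrix_apply_of_ne {i j a b : V} (h1 : ¬(i = a ∧ j = b)) (h2 : ¬(j = a ∧ i = b)) :
    edgeMatrix i j a b = 0 := by
  simp [edgeMatrix, h1, h2]

theorem edgeMatrix_nonneg (i j a b : V) : 0 ≤ edgeMatrix i j a b := by
  simp only [edgeMatrix, Matrix.add_apply, Matrix.single_apply]
  split_ifs <;> norm_num

theorem sub_smul_edgeMatrix_le {A : Matrix V V ℝ} {c : ℝ} (hc : 0 ≤ c) (i j a b : V) :
    (A - c • edgeMatrix i j) a b ≤ A a b := by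
  simpa using mul_nonneg hc (edgeMatrix_nonneg i j a b)

theorem form_edgeMatrix [Fintype V] (i j : V) (x : V → ℝ) :
    x ⬝ᵥ (edgeMatrix i j *ᵥ x) = 2 * (x i * x j) := by
  simp only [edgeMatrix, Matrix.add_mulVec, Matrix.single_mulVec, dotProduct_add, one_mul]
  have h : ∀ (a : V) (c : ℝ), x ⬝ᵥ Function.update 0 a c = x a * c := fun a c =>
    dotProduct_single x c a
  rw [h, h]
  ring

variable [Fintype V] {A : Matrix V V ℝ}

theorem form_sub_smul_edgeMatrix (c : ℝ) (i j : V) (x : V → ℝ) :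
    x ⬝ᵥ ((A - c • edgeMatrix i j) *ᵥ x) = x ⬝ᵥ (A *ᵥ x) - 2 * c * (x i * x j) := by
  rw [Matrix.sub_mulVec, dotProduct_sub, Matrix.smul_mulVec, dotProduct_smul, form_edgeMatrix,
    smul_eq_mul]
  ring

/-- Lowering a nonnegative off-diagonal entry of a strictly copositive matrix down to zero, either
the matrix stays strictly copositive, or at some point a zero shows up. -/
theorem StrictlyCopositive.sub_edgeMatrix_or_exists_zero (hA : StrictlyCopositive A) {i j : V}
    (hij : 0 ≤ A i j) :
    StrictlyCopositive (A - A i j • edgeMatrix i j) ∨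
      ∃ c, 0 < c ∧ c ≤ A i j ∧ CopositiveMatrix (A - c • edgeMatrix i j) ∧
        ∃ u : V → ℝ, (∀ k, 0 ≤ u k) ∧ 0 < u i ∧ 0 < u j ∧
          u ⬝ᵥ ((A - c • edgeMatrix i j) *ᵥ u) = 0 := by
  have hsymm : ∀ c : ℝ, (A - c • edgeMatrix i j).IsSymm := fun c =>
    hA.1.sub ((edgeMatrix_isSymm i j).smul c)
  by_cases hst : StrictlyCopositive (A - A i j • edgeMatrix i j)
  · exact Or.inl hst
  right
  set K : Set (V → ℝ) := stdSimplex ℝ V ∩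
    {x | x ⬝ᵥ ((A - A i j • edgeMatrix i j) *ᵥ x) ≤ 0} with hK
  have hKc : IsCompact K :=
    (isCompact_stdSimplex ℝ V).inter_right (isClosed_le continuous_form continuous_const)
  have hscale : ∀ x : V → ℝ, (∀ k, 0 ≤ x k) → x ≠ 0 →
      ∃ s : ℝ, 0 < s ∧ s • x ∈ stdSimplex ℝ V := by
    intro x hx hx0
    have hpos : 0 < ∑ k, x k := by
      obtain ⟨k, hk⟩ := Function.ne_iff.1 hx0
      exact Finset.sum_pos' (fun k _ => hx k)
        ⟨k, Finset.mem_univ k, lt_of_le_of_ne (hx k) (Ne.symm hk)⟩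
    refine ⟨(∑ k, x k)⁻¹, inv_pos.2 hpos, fun k => mul_nonneg (inv_pos.2 hpos).le (hx k), ?_⟩
    simp only [Pi.smul_apply, smul_eq_mul, ← Finset.mul_sum]
    exact inv_mul_cancel₀ hpos.ne'
  have hKne : K.Nonempty := by
    have : ∃ x : V → ℝ, (∀ k, 0 ≤ x k) ∧ x ≠ 0 ∧
        x ⬝ᵥ ((A - A i j • edgeMatrix i j) *ᵥ x) ≤ 0 := by
      by_contra! hcon
      exact hst ⟨hsymm _, hcon⟩
    obtain ⟨x, hx, hx0, hxn⟩ := this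
    obtain ⟨s, -, hsx⟩ := hscale x hx hx0
    refine ⟨s • x, hsx, ?_⟩
    rw [Set.mem_ofPred_eq, form_smul]
    exact mul_nonpos_of_nonneg_of_nonpos (sq_nonneg s) hxn
  have hKpos : ∀ x ∈ K, 0 < x ⬝ᵥ (A *ᵥ x) ∧ 0 < x i * x j := by
    rintro x ⟨⟨hx, hx1⟩, hxn⟩
    have hx0 : x ≠ 0 := by
      rintro rfl
      simp at hx1
    have h1 := hA.2 x hx hx0
    rw [Set.mem_ofPred_eq, form_sub_smul_edgeMatrix] at hxn
    refine ⟨h1, ?_⟩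
    by_contra! h2
    nlinarith [mul_nonneg (hx i) (hx j)]
  -- The ratio is the amount by which the entry can drop before the form vanishes at `x`; its
  -- minimum over `K` is the critical amount.
  obtain ⟨u, huK, hmin⟩ := hKc.exists_isMinOn hKne
    (f := fun x => x ⬝ᵥ (A *ᵥ x) / (2 * (x i * x j))) <| by
      refine ContinuousOn.div continuous_form.continuousOn (by fun_prop) fun x hx => ?_
      have := (hKpos x hx).2
      positivity
  obtain ⟨hu1, hu2⟩ := hKpos u huK
  set c := u ⬝ᵥ (A *ᵥ u) / (2 * (u i * u j)) with hc
  have hcle : c ≤ A i j := by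
    have := huK.2
    rw [Set.mem_ofPred_eq, form_sub_smul_edgeMatrix] at this
    rw [hc, div_le_iff₀ (by positivity)]
    linarith
  refine ⟨c, by positivity, hcle, ⟨hsymm c, ?_⟩, u, huK.1.1, ?_, ?_, ?_⟩
  · intro x hx
    by_cases hx0 : x = 0
    · simp [hx0]
    obtain ⟨s, hs, hsx⟩ := hscale x hx hx0
    suffices h : 0 ≤ (s • x) ⬝ᵥ ((A - c • edgeMatrix i j) *ᵥ (s • x)) by
      rw [form_smul] at h
      exact nonneg_of_mul_nonneg_right h (by positivity)
    by_cases hsK : s • x ∈ K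
    · have h1 : c ≤ _ := hmin hsK
      have h2 := (hKpos _ hsK).2
      rw [le_div_iff₀ (by positivity)] at h1
      rw [form_sub_smul_edgeMatrix]
      linarith
    · have h1 : 0 < (s • x) ⬝ᵥ ((A - A i j • edgeMatrix i j) *ᵥ (s • x)) := by
        by_contra! h
        exact hsK ⟨hsx, h⟩
      rw [form_sub_smul_edgeMatrix] at h1 ⊢
      nlinarith [mul_nonneg (hsx.1 i) (hsx.1 j)]
  · exact pos_of_mul_pos_left hu2 (huK.1.1 j)
  · exact pos_of_mul_pos_right hu2 (huK.1.1 i)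
  · rw [form_sub_smul_edgeMatrix, hc]
    have : u i * u j ≠ 0 := hu2.ne'
    generalize u i * u j = p at this
    field_simp
    ring

end EdgeMatrix

/-! ### Diananda's theorem for order at most four. -/

section SmallOrder
variable {V : Type*} [Fintype V] {A : Matrix V V ℝ}

theorem form_nonneg_of_nonpos_offDiag (hA : CopositiveMatrix A) {x : V → ℝ}
    (h : ∀ i j, i ≠ j → A i j ≤ 0 ∨ x i = 0 ∨ x j = 0) : 0 ≤ x ⬝ᵥ (A *ᵥ x) := by
  refine (hA.2 (fun i => |x i|) fun i => abs_nonneg _).trans ?_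
  simp only [dotProduct, Matrix.mulVec, Finset.mul_sum]
  refine Finset.sum_le_sum fun i _ => Finset.sum_le_sum fun j _ => ?_
  by_cases hij : i = j
  · subst hij
    refine le_of_eq ?_
    linear_combination A i i * abs_mul_abs_self (x i)
  · rcases h i j hij with h1 | h1 | h1
    · have h2 : x i * x j ≤ |x i| * |x j| := by
        rw [← abs_mul]; exact le_abs_self _
      nlinarith
    · simp [h1]
    · simp [h1]

theorem StrictlyCopositive.diag_pos (hA : StrictlyCopositive A) (i : V) : 0 < A i i := by
  classical
  have h := hA.2 (Pi.single i 1) (fun k => ?_) (by simp)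
  · simpa [Matrix.mulVec_single] using h
  · by_cases hk : k = i
    · subst hk; simp
    · simp [hk]

/-- At a zero `u` of a copositive matrix with positive diagonal, each index in the support of `u`
has a negative entry towards the support. -/
theorem exists_neg_of_zero (hA : CopositiveMatrix A) {u : V → ℝ} (hu : ∀ k, 0 ≤ u k)
    (h0 : u ⬝ᵥ (A *ᵥ u) = 0) {i : V} (hii : 0 < A i i) (hi : 0 < u i) :
    ∃ k, k ≠ i ∧ 0 < u k ∧ A i k < 0 := by
  have h1 : ∑ k, A i k * u k = 0 := hA.mulVec_zero_eq_zero hu h0 hi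
  by_contra! hcon
  have h2 : A i i * u i ≤ ∑ k, A i k * u k := by
    refine Finset.single_le_sum (f := fun k => A i k * u k) (fun k _ => ?_) (Finset.mem_univ i)
    by_cases hk : k = i
    · subst hk; positivity
    · rcases (hu k).eq_or_lt with h | h
      · simp [← h]
      · exact mul_nonneg (hcon k hk h) h.le
  have := mul_pos hii hi
  linarith

/-- Induction on the number of positive off-diagonal entries. With none, replacing `x` by `|x|` only
decreases the form. Otherwise lower one: if a zero appears, its support contains `i`, `j` and a
negative neighbour of `i`, hence misses at most one vertex. -/
theorem StrictlyCopositive.spn_of_card_le_four [DecidableEq V] (hV : Fintype.card V ≤ 4) (n : ℕ)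
    (A : Matrix V V ℝ) (hA : StrictlyCopositive A)
    (hn : (Finset.univ.filter fun p : V × V => p.1 ≠ p.2 ∧ 0 < A p.1 p.2).card ≤ n) :
    SPNMatrix A := by
  induction n generalizing A with
  | zero =>
    refine _root_.spn_of_form_nonneg hA.1 fun x =>
      form_nonneg_of_nonpos_offDiag hA.copositive fun i j hij => Or.inl ?_
    by_contra! h
    have : (i, j) ∈ Finset.univ.filter fun p : V × V => p.1 ≠ p.2 ∧ 0 < A p.1 p.2 := by
      simp [hij, h]
    rw [Finset.card_eq_zero.1 (Nat.le_zero.1 hn)] at this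
    simp at this
  | succ n ih =>
    by_cases hpos : ∃ i j, i ≠ j ∧ 0 < A i j
    · obtain ⟨i, j, hij, hAij⟩ := hpos
      rcases hA.sub_edgeMatrix_or_exists_zero hAij.le with h | ⟨c, hc0, hc, hcop, u, hu, hui, huj, h0⟩
      · refine SPNMatrix.mono (ih _ h ?_) h.1 hA.1 (sub_smul_edgeMatrix_le hAij.le i j)
        refine Nat.le_of_lt_succ (lt_of_lt_of_le (Finset.card_lt_card ?_) hn)
        refine (Finset.ssubset_iff_of_subset fun p hp => ?_).2 ⟨(i, j), by simp [hij, hAij], ?_⟩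
        · simp only [Finset.mem_filter, Finset.mem_univ, true_and] at hp ⊢
          exact ⟨hp.1, hp.2.trans_le (sub_smul_edgeMatrix_le hAij.le i j _ _)⟩
        · simp [edgeMatrix_self_left hij]
      · refine SPNMatrix.mono ?_ hcop.1 hA.1 (sub_smul_edgeMatrix_le hc0.le i j)
        have hij' : 0 ≤ (A - c • edgeMatrix i j) i j := by
          simp [edgeMatrix_self_left hij, hc]
        have hii : 0 < (A - c • edgeMatrix i j) i i := by
          simpa [edgeMatrix_apply_of_ne (i := i) (j := j) (a := i) (b := i) (by simp [hij.symm])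
            (by simp [hij.symm])] using hA.diag_pos i
        obtain ⟨k, hki, huk, hk⟩ := exists_neg_of_zero hcop hu h0 hii hui
        have hkj : k ≠ j := fun h => by subst h; linarith
        have hcard : (Finset.univ \ {i, j, k} : Finset V).card ≤ 1 := by
          have h3 : ({i, j, k} : Finset V).card = 3 := by
            rw [Finset.card_eq_three]
            exact ⟨i, j, k, hij, hki.symm, hkj.symm, rfl⟩
          rw [Finset.card_sdiff_of_subset (Finset.subset_univ _), Finset.card_univ, h3]
          omega
        obtain ⟨v, hv⟩ : ∃ v, ∀ w, w ≠ v → w ∈ ({i, j, k} : Finset V) := by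
          by_cases he : (Finset.univ \ {i, j, k} : Finset V).Nonempty
          · obtain ⟨v, hv⟩ := he
            refine ⟨v, fun w hw => ?_⟩
            by_contra hwn
            exact hw (Finset.card_le_one.1 hcard w (by simpa using hwn) v hv)
          · refine ⟨i, fun w _ => ?_⟩
            by_contra hwn
            exact he ⟨w, by simpa using hwn⟩
        refine hcop.spn_of_zero hu h0 v fun w hw => ?_
        have := hv w hw
        simp only [Finset.mem_insert, Finset.mem_singleton] at this
        rcases this with rfl | rfl | rfl <;> exact ne_of_gt (by assumption)
    · push Not at hpos
      exact _root_.spn_of_form_nonneg hA.1 fun x =>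
        form_nonneg_of_nonpos_offDiag hA.copositive fun i j hij => Or.inl (hpos i j hij)

/-- Copositive matrices of order at most four are SPN (Diananda). -/
theorem CopositiveMatrix.spn_of_card_le_four (hV : Fintype.card V ≤ 4) (hA : CopositiveMatrix A) :
    SPNMatrix A := by
  classical
  exact spn_of_strictlyCopositive_add hA fun ε _ h =>
    StrictlyCopositive.spn_of_card_le_four hV _ _ h le_rfl

end SmallOrder

/-! ### Order five: reduction to order four by a row. -/

section Rows
variable {V : Type*} [Fintype V] {A : Matrix V V ℝ}

theorem CopositiveMatrix.spn_of_row_eq_zero (hV : Fintype.card V = 5) (hA : CopositiveMatrix A)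
    (v : V) (h : ∀ j, A v j = 0) : SPNMatrix A := by
  classical
  have hs := hA.1
  set f : {w // w ≠ v} → V := Subtype.val with hf
  -- `C` deletes coordinate `v`, and `Cᵀ * M * C` borders `M` by a zero row and column.
  set C : Matrix {w // w ≠ v} V ℝ := Matrix.of fun a b => if a.1 = b then 1 else 0 with hC
  have hCx : ∀ x, Cᵀ *ᵥ x = fun b => if hb : b ≠ v then x ⟨b, hb⟩ else 0 := by
    intro x
    ext b
    simp only [Matrix.mulVec, dotProduct, Matrix.transpose_apply, hC, Matrix.of_apply, ite_mul,
      one_mul, zero_mul]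
    split_ifs with hb
    · rw [Finset.sum_eq_single ⟨b, hb⟩]
      · simp
      · intro a _ hab
        rw [if_neg fun h : a.1 = b => hab (Subtype.ext h)]
      · simp
    · refine Finset.sum_eq_zero fun a _ => ?_
      rw [if_neg fun h : a.1 = b => hb (h ▸ a.2)]
  have hCA : Cᵀ * A.submatrix f f * C = A := by
    ext a b
    have h1 : ∀ (M : Matrix {w // w ≠ v} {w // w ≠ v} ℝ), (Cᵀ * M * C) a b =
        if ha : a ≠ v then if hb : b ≠ v then M ⟨a, ha⟩ ⟨b, hb⟩ else 0 else 0 := by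
      intro M
      have e1 : (Cᵀ * M * C) a b = (Cᵀ *ᵥ fun i => (Cᵀ *ᵥ M i) b) a := by
        rw [Matrix.mul_assoc]
        simp only [Matrix.mul_apply, Matrix.mulVec, dotProduct, Matrix.transpose_apply]
        refine Finset.sum_congr rfl fun i _ => ?_
        congr 1
        exact Finset.sum_congr rfl fun j _ => mul_comm _ _
      rw [e1, hCx]
      simp only [hCx]
    rw [h1]
    split_ifs with ha hb
    · rfl
    · rw [not_not.1 hb, ← hs.apply, h]
    · rw [not_not.1 ha, h]
  have hsub : CopositiveMatrix (A.submatrix f f) := by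
    refine ⟨hs.submatrix f, fun x hx => ?_⟩
    have h1 := hA.2 (Cᵀ *ᵥ x) fun b => ?_
    · rw [hCx] at h1
      simp only [dotProduct, Matrix.mulVec] at h1 ⊢
      rw [Fintype.sum_eq_add_sum_subtype_ne _ v] at h1
      simp only [ne_eq, not_true_eq_false, dite_false, zero_mul, zero_add] at h1
      convert h1 using 2 with a
      rw [Fintype.sum_eq_add_sum_subtype_ne _ v]
      simp only [a.2, hf, not_false_eq_true, dite_true, ne_eq, not_true_eq_false, dite_false,
        mul_zero, zero_add, Matrix.submatrix_apply]
      exact congrArg _ (Finset.sum_congr rfl fun j _ => by rw [dif_pos j.2])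
    · rw [hCx]
      show 0 ≤ dite _ _ _
      split_ifs
      · exact hx _
      · rfl
  rw [← hCA]
  refine SPNMatrix.transpose_mul_mul (hsub.spn_of_card_le_four ?_) fun i j => ?_
  · rw [Fintype.card_subtype_compl, hV]
    simp
  · simp only [hC, Matrix.of_apply]
    split_ifs <;> norm_num

end Rows

/-! ### Rows of constant sign and vertices of degree two. -/

section Rows
variable {V : Type*} [Fintype V] {A : Matrix V V ℝ}

theorem CopositiveMatrix.diag_nonneg (hA : CopositiveMatrix A) (i : V) : 0 ≤ A i i := by
  classical
  have h := hA.2 (Pi.single i 1) (fun k => ?_)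
  · simpa [Matrix.mulVec_single] using h
  · by_cases hk : k = i
    · subst hk; simp
    · simp [hk]

/-- Replacing row and column `v` by zeros keeps copositivity and only lowers entries. -/
theorem CopositiveMatrix.spn_of_row_nonneg (hV : Fintype.card V = 5) (hA : CopositiveMatrix A)
    (v : V) (h : ∀ j, j ≠ v → 0 ≤ A v j) : SPNMatrix A := by
  classical
  have h' : ∀ j, 0 ≤ A v j := fun j => by
    by_cases hj : j = v
    · rw [hj]; exact hA.diag_nonneg v
    · exact h j hj
  set w : V → ℝ := fun i => if i = v then 0 else 1 with hw
  set B := Matrix.diagonal w * A * Matrix.diagonal w with hB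
  have hBij : ∀ i j, B i j = w i * A i j * w j := fun i j => by
    rw [hB, Matrix.mul_diagonal, Matrix.diagonal_mul]
  have hBs : B.IsSymm := by
    ext i j
    rw [Matrix.transpose_apply, hBij, hBij, hA.1.apply]
    ring
  have hBc : CopositiveMatrix B := by
    refine ⟨hBs, fun x hx => ?_⟩
    have h1 := hA.2 (fun i => w i * x i) fun i => mul_nonneg (by
      simp only [hw]; split_ifs <;> norm_num) (hx i)
    simp only [dotProduct, Matrix.mulVec, hBij] at h1 ⊢
    refine h1.trans_eq (Finset.sum_congr rfl fun i _ => ?_)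
    rw [mul_comm (w i), mul_assoc, Finset.mul_sum]
    congr 1
    exact Finset.sum_congr rfl fun j _ => by ring
  refine (hBc.spn_of_row_eq_zero hV v fun j => by simp [hBij, hw]).mono hBs hA.1 fun i j => ?_
  rw [hBij]
  by_cases hi : i = v
  · subst hi; simpa [hw] using h' j
  · by_cases hj : j = v
    · subst hj
      rw [← hA.1.apply]
      simpa [hw] using h' i
    · simp [hw, hi, hj]

/-- Pass to the Schur complement `B` at `v`. It is copositive: a nonnegative `x` can be moved along
`e_v` until `A v ⬝ᵥ x = 0`, where the two forms agree, and the sign of the row keeps coordinate `v`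
nonnegative. -/
theorem StrictlyCopositive.spn_of_row_nonpos (hV : Fintype.card V = 5) (hA : StrictlyCopositive A)
    (v : V) (h : ∀ j, j ≠ v → A v j ≤ 0) : SPNMatrix A := by
  classical
  have hvv := hA.diag_pos v
  set B := A - (A v v)⁻¹ • Matrix.vecMulVec (A v) (A v) with hB
  have hBv : ∀ j, B v j = 0 := fun j => by
    simp only [hB, Matrix.sub_apply, Matrix.smul_apply, Matrix.vecMulVec_apply, smul_eq_mul]
    field_simp
    ring
  have hform : ∀ x, x ⬝ᵥ (B *ᵥ x) = x ⬝ᵥ (A *ᵥ x) - (A v v)⁻¹ * (A v ⬝ᵥ x) ^ 2 := fun x => by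
    rw [hB, Matrix.sub_mulVec, dotProduct_sub, Matrix.smul_mulVec, Matrix.vecMulVec_mulVec,
      dotProduct_smul]
    simp only [dotProduct_comm x (A v), smul_eq_mul, MulOpposite.smul_eq_mul_unop,
      MulOpposite.unop_op, dotProduct_smul]
    ring
  have hBs : B.IsSymm := by
    refine hA.1.sub (Matrix.IsSymm.smul ?_ _)
    rw [Matrix.IsSymm, Matrix.transpose_vecMulVec]
  have hBc : CopositiveMatrix B := by
    refine ⟨hBs, fun x hx => ?_⟩
    set s := -(A v ⬝ᵥ x) / A v v with hs
    have h1 := form_add_single hBs x v s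
    have h2 : (B *ᵥ x) v = 0 := Finset.sum_eq_zero fun j _ =>
      mul_eq_zero_of_left (hBv j) _
    have h3 : A v ⬝ᵥ (x + Pi.single v s) = 0 := by
      rw [dotProduct_add, dotProduct_single, hs]
      field_simp
      ring
    rw [h2, hBv, hform, h3] at h1
    have h4 := hA.copositive.2 (x + Pi.single v s) (add_single_nonneg hx ?_)
    · linarith
    · have h5 : A v ⬝ᵥ x ≤ A v v * x v := by
        rw [dotProduct, ← Finset.add_sum_erase _ _ (Finset.mem_univ v)]
        have := Finset.sum_nonpos (s := Finset.univ.erase v) (f := fun j => A v j * x j)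
          fun j hj => mul_nonpos_of_nonpos_of_nonneg (h j (Finset.ne_of_mem_erase hj)) (hx j)
        linarith
      have h6 : x v + s = (A v v * x v - A v ⬝ᵥ x) / A v v := by
        rw [hs]; field_simp; ring
      rw [h6]
      exact div_nonneg (by linarith) hvv.le
  obtain ⟨P, N, hP, hN, hN0, hPN⟩ := hBc.spn_of_row_eq_zero hV v hBv
  refine ⟨P + (A v v)⁻¹ • Matrix.vecMulVec (A v) (A v), N, hP.add ?_, hN, hN0, ?_⟩
  · have h7 := Matrix.posSemidef_vecMulVec_self_star (A v)
    simp only [star_trivial] at h7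
    exact h7.smul (inv_pos.2 hvv).le
  · rw [add_right_comm, ← hPN, hB, sub_add_cancel]

/-- Otherwise row `v` has constant sign off the diagonal. -/
theorem StrictlyCopositive.mixed_signs_of_degree_two (hV : Fintype.card V = 5)
    (hA : StrictlyCopositive A) (hn : ¬SPNMatrix A) {v d e : V}
    (h : ∀ j, j ≠ v → j ≠ d → j ≠ e → A v j = 0) :
    (A v d < 0 ∧ 0 < A v e) ∨ (A v e < 0 ∧ 0 < A v d) := by
  by_contra! hcon
  rcases le_or_gt 0 (A v d) with hd | hd
  · rcases le_or_gt 0 (A v e) with he | he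
    · refine hn (hA.copositive.spn_of_row_nonneg hV v fun j hj => ?_)
      by_cases hjd : j = d
      · rwa [hjd]
      · by_cases hje : j = e
        · rwa [hje]
        · rw [h j hj hjd hje]
    · refine hn (hA.spn_of_row_nonpos hV v fun j hj => ?_)
      by_cases hjd : j = d
      · rw [hjd]; exact hcon.2 he
      · by_cases hje : j = e
        · rw [hje]; exact he.le
        · rw [h j hj hjd hje]
  · refine hn (hA.spn_of_row_nonpos hV v fun j hj => ?_)
    by_cases hjd : j = d
    · rw [hjd]; exact hd.le
    · by_cases hje : j = e
      · rw [hje]; exact hcon.1 hd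
      · rw [h j hj hjd hje]

/-- If a strictly copositive matrix of order five that is not SPN has a vertex `v` with only two
neighbours `d` and `e`, joined to it by a negative and a positive entry, then lowering the positive
entry produces a copositive matrix with a zero supported exactly on the triangle. -/
theorem StrictlyCopositive.exists_triangle_zero [DecidableEq V] (hV : Fintype.card V = 5)
    (hA : StrictlyCopositive A) (hn : ¬SPNMatrix A) {v d e : V} (hvd : v ≠ d) (hve : v ≠ e)
    (hde : d ≠ e) (h : ∀ j, j ≠ v → j ≠ d → j ≠ e → A v j = 0) (hd : A v d < 0) (he : 0 < A v e) :
    ∃ c, 0 < c ∧ c ≤ A v e ∧ CopositiveMatrix (A - c • edgeMatrix v e) ∧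
      ∃ u : V → ℝ, (∀ j, 0 ≤ u j) ∧ u ⬝ᵥ ((A - c • edgeMatrix v e) *ᵥ u) = 0 ∧
        0 < u v ∧ 0 < u d ∧ 0 < u e ∧ (∀ j, j ≠ v → j ≠ d → j ≠ e → u j = 0) ∧ A e d < 0 := by
  rcases hA.sub_edgeMatrix_or_exists_zero he.le with h1 | ⟨c, hc0, hc, hcop, u, hu, huv, hue, h0⟩
  · refine absurd ((h1.spn_of_row_nonpos hV v fun j hj => ?_).mono h1.1 hA.1
      (sub_smul_edgeMatrix_le he.le v e)) hn
    by_cases hje : j = e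
    · subst hje; simp [edgeMatrix_self_left hve]
    · refine (sub_smul_edgeMatrix_le he.le v e v j).trans ?_
      by_cases hjd : j = d
      · rw [hjd]; exact hd.le
      · rw [h j hj hjd hje]
  · have hne : ∀ a b, ¬(v = a ∧ e = b) → ¬(e = a ∧ v = b) →
        (A - c • edgeMatrix v e) a b = A a b := fun a b h1 h2 => by
      simp [edgeMatrix_apply_of_ne h1 h2]
    have hve' : 0 ≤ (A - c • edgeMatrix v e) v e := by simp [edgeMatrix_self_left hve, hc]
    have hud : 0 < u d := by
      have hvv := hA.diag_pos v
      rw [← hne v v (by simp [hve.symm]) (by simp [hve.symm])] at hvv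
      obtain ⟨k, hkv, huk, hk⟩ := exists_neg_of_zero hcop hu h0 hvv huv
      have hke : k ≠ e := fun h => by subst h; linarith
      rw [hne v k (by simp [hke.symm]) (by simp [hve.symm])] at hk
      by_cases hkd : k = d
      · rwa [← hkd]
      · rw [h k hkv hkd hke] at hk
        exact absurd hk (lt_irrefl 0)
    -- A fourth support vertex would leave only one vertex outside, and
    -- `CopositiveMatrix.spn_of_zero` would apply.
    have hzero : ∀ j, j ≠ v → j ≠ d → j ≠ e → u j = 0 := by
      classical
      intro j hjv hjd hje
      by_contra hj
      have hcard : ({v, d, e, j} : Finset V).card = 4 := by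
        rw [Finset.card_insert_of_notMem (by simp [hvd, hve, Ne.symm hjv]),
          Finset.card_insert_of_notMem (by simp [hde, Ne.symm hjd]),
          Finset.card_pair (Ne.symm hje)]
      have hc1 : (Finset.univ \ {v, d, e, j} : Finset V).card = 1 := by
        rw [Finset.card_sdiff_of_subset (Finset.subset_univ _), Finset.card_univ, hcard, hV]
      obtain ⟨w, hw⟩ := Finset.card_eq_one.1 hc1
      refine hn ((hcop.spn_of_zero hu h0 w fun i hi => ?_).mono hcop.1 hA.1
        (sub_smul_edgeMatrix_le hc0.le v e))
      have : i ∉ (Finset.univ \ {v, d, e, j} : Finset V) := by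
        rw [hw]; simpa using hi
      simp only [Finset.mem_sdiff, Finset.mem_univ, true_and, not_not, Finset.mem_insert,
        Finset.mem_singleton] at this
      rcases this with rfl | rfl | rfl | rfl
      exacts [huv.ne', hud.ne', hue.ne', hj]
    refine ⟨c, hc0, hc, hcop, u, hu, h0, huv, hud, hue, hzero, ?_⟩
    have hee := hA.diag_pos e
    rw [← hne e e (by simp [hve]) (by simp [hve])] at hee
    obtain ⟨k, hke, huk, hk⟩ := exists_neg_of_zero hcop hu h0 hee hue
    have hkv : k ≠ v := fun h => by
      subst h
      rw [hcop.1.apply] at hk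
      linarith
    rw [hne e k (by simp [hve]) (by simp [hkv.symm])] at hk
    by_cases hkd : k = d
    · rwa [← hkd]
    · rw [hzero k hkv hkd hke] at huk
      exact absurd huk (lt_irrefl 0)

end Rows

/-! ### The complement configurations in order five. -/

section OrderFive
variable {A : Matrix (Fin 5) (Fin 5) ℝ}

theorem form_fin_five (hA : A.IsSymm) (x : Fin 5 → ℝ) : x ⬝ᵥ (A *ᵥ x) =
    A 0 0 * x 0 ^ 2 + A 1 1 * x 1 ^ 2 + A 2 2 * x 2 ^ 2 + A 3 3 * x 3 ^ 2 + A 4 4 * x 4 ^ 2 +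
    2 * (A 0 1 * (x 0 * x 1) + A 0 2 * (x 0 * x 2) + A 0 3 * (x 0 * x 3) + A 0 4 * (x 0 * x 4) +
      A 1 2 * (x 1 * x 2) + A 1 3 * (x 1 * x 3) + A 1 4 * (x 1 * x 4) +
      A 2 3 * (x 2 * x 3) + A 2 4 * (x 2 * x 4) + A 3 4 * (x 3 * x 4)) := by
  simp only [dotProduct, Matrix.mulVec, Fin.sum_univ_five]
  rw [hA.apply 0 1, hA.apply 0 2, hA.apply 0 3, hA.apply 0 4, hA.apply 1 2, hA.apply 1 3,
    hA.apply 1 4, hA.apply 2 3, hA.apply 2 4, hA.apply 3 4]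
  ring

theorem fin_five_cases {p : Fin 5 → Prop} (h0 : p 0) (h1 : p 1) (h2 : p 2) (h3 : p 3) (h4 : p 4) :
    ∀ i, p i := by
  intro i
  fin_cases i <;> assumption

/-- The complement contains a star with three leaves. -/
theorem StrictlyCopositive.spn_of_star (hA : StrictlyCopositive A) (h1 : A 0 1 = 0)
    (h2 : A 0 2 = 0) (h3 : A 0 3 = 0) : SPNMatrix A := by
  by_contra hn
  have := hA.mixed_signs_of_degree_two (by simp) hn (v := 0) (d := 3) (e := 4)
    (fin_five_cases (by simp) (by simp [h1]) (by simp [h2]) (by simp) (by simp))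
  rw [h3] at this
  simp at this

/-- The complement contains the disjoint union of a path of length two and an edge. -/
theorem StrictlyCopositive.spn_of_path_edge (hA : StrictlyCopositive A) (h1 : A 0 1 = 0)
    (h2 : A 1 2 = 0) (h3 : A 3 4 = 0) : SPNMatrix A := by
  by_contra hn
  have h1' : A 1 0 = 0 := by rw [hA.1.apply, h1]
  have h3' : A 4 3 = 0 := by rw [hA.1.apply, h3]
  have hz : ∀ j : Fin 5, j ≠ 1 → j ≠ 3 → j ≠ 4 → A 1 j = 0 :=
    fin_five_cases (by simp [h1']) (by simp) (by simp [h2]) (by simp) (by simp)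
  rcases hA.mixed_signs_of_degree_two (by simp) hn hz with ⟨hd, he⟩ | ⟨hd, he⟩
  · obtain ⟨c, -, -, -, u, -, -, -, -, -, -, hneg⟩ := hA.exists_triangle_zero (by simp) hn
      (by simp) (by simp) (by simp) hz hd he
    exact hneg.ne h3'
  · obtain ⟨c, -, -, -, u, -, -, -, -, -, -, hneg⟩ := hA.exists_triangle_zero (by simp) hn
      (by simp) (by simp) (by simp) (fun j a b c => hz j a c b) hd he
    exact hneg.ne h3

/-- A copositive matrix on the bowtie with a zero supported on one of the triangles is SPN. -/
theorem CopositiveMatrix.spn_of_bowtie_zero (hA : CopositiveMatrix A) (h1 : A 0 1 = 0)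
    (h2 : A 1 2 = 0) (h3 : A 2 3 = 0) (h4 : A 0 3 = 0) {u : Fin 5 → ℝ} (hu : ∀ i, 0 ≤ u i)
    (h0 : u ⬝ᵥ (A *ᵥ u) = 0) (hu0 : 0 < u 0) (hu1 : u 1 = 0) (hu2 : 0 < u 2) (hu3 : u 3 = 0)
    (hu4 : 0 < u 4) : SPNMatrix A := by
  have h14 : 0 ≤ A 1 4 := by
    have := hA.mulVec_zero_nonneg hu h0 1
    simp only [Matrix.mulVec, dotProduct, Fin.sum_univ_five, hu1, hu3, h2, hA.1.apply 0 1, h1,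
      zero_mul, mul_zero, zero_add] at this
    exact nonneg_of_mul_nonneg_left this hu4
  have h34 : 0 ≤ A 3 4 := by
    have := hA.mulVec_zero_nonneg hu h0 3
    simp only [Matrix.mulVec, dotProduct, Fin.sum_univ_five, hu1, hu3, h4, hA.1.apply 0 3,
      hA.1.apply 2 3, h3, zero_mul, mul_zero, zero_add] at this
    exact nonneg_of_mul_nonneg_left this hu4
  -- Dropping these two nonnegative entries decouples the blocks `{0, 2, 4}` and `{1, 3}`; the first
  -- is positive semidefinite because it supports the zero.
  set B := A - A 1 4 • edgeMatrix 1 4 - A 3 4 • edgeMatrix 3 4 with hB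
  have hBs : B.IsSymm := (hA.1.sub ((edgeMatrix_isSymm _ _).smul _)).sub
    ((edgeMatrix_isSymm _ _).smul _)
  have hform : ∀ x, x ⬝ᵥ (B *ᵥ x) = ![x 0, 0, x 2, 0, x 4] ⬝ᵥ (A *ᵥ ![x 0, 0, x 2, 0, x 4]) +
      (A 1 1 * x 1 ^ 2 + A 3 3 * x 3 ^ 2 + 2 * A 1 3 * (x 1 * x 3)) := by
    intro x
    rw [hB, form_sub_smul_edgeMatrix, form_sub_smul_edgeMatrix, form_fin_five hA.1,
      form_fin_five hA.1]
    simp [h1, h2, h3, h4]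
    ring
  have hface : ∀ x : Fin 5 → ℝ,
      0 ≤ ![x 0, 0, x 2, 0, x 4] ⬝ᵥ (A *ᵥ ![x 0, 0, x 2, 0, x 4]) := fun x =>
    hA.form_nonneg_of_support hu h0 (fin_five_cases (by simp [hu0.ne']) (by simp)
      (by simp [hu2.ne']) (by simp) (by simp [hu4.ne']))
  have hBc : CopositiveMatrix B := by
    refine ⟨hBs, fun x hx => ?_⟩
    have h5 := hA.2 ![0, x 1, 0, x 3, 0] (fin_five_cases (by simp) (by simpa using hx 1) (by simp)
      (by simpa using hx 3) (by simp))
    rw [form_fin_five hA.1] at h5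
    simp at h5
    rw [hform]
    linarith [hface x]
  refine (hBc.spn_of_form_nonneg 1 fun x hx => ?_).mono hBs hA.1 fun i j => ?_
  · rw [hform, hx]
    have := mul_nonneg (hA.diag_nonneg 3) (sq_nonneg (x 3))
    have := hface x
    nlinarith
  · exact (sub_smul_edgeMatrix_le h34 3 4 i j).trans (sub_smul_edgeMatrix_le h14 1 4 i j)

/-- The complement contains a cycle of length four. -/
theorem StrictlyCopositive.spn_of_cycle (hA : StrictlyCopositive A) (h1 : A 0 1 = 0)
    (h2 : A 1 2 = 0) (h3 : A 2 3 = 0) (h4 : A 0 3 = 0) : SPNMatrix A := by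
  by_contra hn
  have hz : ∀ j : Fin 5, j ≠ 0 → j ≠ 2 → j ≠ 4 → A 0 j = 0 :=
    fin_five_cases (by simp) (by simp [h1]) (by simp) (by simp [h4]) (by simp)
  rcases hA.mixed_signs_of_degree_two (by simp) hn hz with ⟨hd, he⟩ | ⟨hd, he⟩
  · obtain ⟨c, hc0, hc, hcop, u, hu, h0, huv, hud, hue, hsupp, -⟩ :=
      hA.exists_triangle_zero (by simp) hn (by simp) (by simp) (by simp) hz hd he
    refine hn ((hcop.spn_of_bowtie_zero ?_ ?_ ?_ ?_ hu h0 huv (hsupp 1 (by simp) (by simp) (by simp))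
      hud (hsupp 3 (by simp) (by simp) (by simp)) hue).mono hcop.1 hA.1
      (sub_smul_edgeMatrix_le hc0.le _ _)) <;> simp [edgeMatrix_apply_of_ne, h1, h2, h3, h4]
  · obtain ⟨c, hc0, hc, hcop, u, hu, h0, huv, hud, hue, hsupp, -⟩ :=
      hA.exists_triangle_zero (by simp) hn (by simp) (by simp) (by simp)
        (fun j a b c => hz j a c b) hd he
    refine hn ((hcop.spn_of_bowtie_zero ?_ ?_ ?_ ?_ hu h0 huv (hsupp 1 (by simp) (by simp) (by simp))
      hue (hsupp 3 (by simp) (by simp) (by simp)) hud).mono hcop.1 hA.1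
      (sub_smul_edgeMatrix_le hc0.le _ _)) <;> simp [edgeMatrix_apply_of_ne, h1, h2, h3, h4]

/-- Three independent vertices `0, 1, 2`, all joined to `3` and `4`, when `0` and `1` are both
negatively joined to `3` and `2` is positively joined to `3`, and a zero is supported on
`{0, 3, 4}`. -/
theorem CopositiveMatrix.spn_of_book_zero (hA : CopositiveMatrix A) (h01 : A 0 1 = 0)
    (h02 : A 0 2 = 0) (h12 : A 1 2 = 0) (h03 : A 0 3 ≤ 0) (h13 : A 1 3 ≤ 0) (h23 : 0 ≤ A 2 3)
    {u : Fin 5 → ℝ} (hu : ∀ i, 0 ≤ u i) (h0 : u ⬝ᵥ (A *ᵥ u) = 0) (hu0 : 0 < u 0) (hu1 : u 1 = 0)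
    (hu2 : u 2 = 0) (hu3 : 0 < u 3) (hu4 : 0 < u 4) : SPNMatrix A := by
  have hr1 : 0 ≤ A 1 3 * u 3 + A 1 4 * u 4 := by
    have := hA.mulVec_zero_nonneg hu h0 1
    simpa [Matrix.mulVec, dotProduct, Fin.sum_univ_five, hu1, hu2, hA.1.apply 0 1, h01] using this
  have hr2 : 0 ≤ A 2 3 * u 3 + A 2 4 * u 4 := by
    have := hA.mulVec_zero_nonneg hu h0 2
    simpa [Matrix.mulVec, dotProduct, Fin.sum_univ_five, hu1, hu2, hA.1.apply 0 2, h02] using this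
  set t := u 3 / u 4 with ht
  have ht0 : 0 < t := div_pos hu3 hu4
  have hut : u 3 = t * u 4 := by rw [ht]; field_simp
  have hr1' : 0 ≤ A 1 4 + A 1 3 * t := by
    refine nonneg_of_mul_nonneg_left (b := u 4) ?_ hu4
    rw [hut] at hr1
    linarith
  have hr2' : 0 ≤ A 2 4 + A 2 3 * t := by
    refine nonneg_of_mul_nonneg_left (b := u 4) ?_ hu4
    rw [hut] at hr2
    linarith
  -- Exactly the amount that makes row 1 of `B` annihilate `u`.
  set c := A 1 4 + A 1 3 * t with hc
  set B := A - c • edgeMatrix 1 4 with hB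
  have hBs : B.IsSymm := hA.1.sub ((edgeMatrix_isSymm _ _).smul _)
  have hBij : ∀ a b, ¬(1 = a ∧ 4 = b) → ¬(4 = a ∧ 1 = b) → B a b = A a b := fun a b h1 h2 => by
    simp [hB, edgeMatrix_apply_of_ne h1 h2]
  have hform : ∀ x, x ⬝ᵥ (B *ᵥ x) = x ⬝ᵥ (A *ᵥ x) - 2 * c * (x 1 * x 4) := fun x =>
    form_sub_smul_edgeMatrix c 1 4 x
  -- Since `B *ᵥ u` vanishes at 0, 1 and 3, coordinate 4 can be cleared along `u`. What remains
  -- lives on `{0, 1, 3}`, where no off-diagonal entry is positive.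
  have hface : ∀ x : Fin 5 → ℝ, x 2 = 0 → 0 ≤ x ⬝ᵥ (B *ᵥ x) := by
    intro x hx2
    set z := x - (x 4 / u 4) • u with hz
    have hz4 : z 4 = 0 := by simp [hz, div_mul_cancel₀ _ hu4.ne']
    have hz2 : z 2 = 0 := by simp [hz, hx2, hu2]
    have hx : x = z + (x 4 / u 4) • u := by simp [hz]
    have huu : u ⬝ᵥ (B *ᵥ u) = 0 := by rw [hform, h0, hu1]; ring
    have hz1 : (B *ᵥ u) 1 = 0 := by
      simp only [Matrix.mulVec, dotProduct, Fin.sum_univ_five, hu1, hu2, hut]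
      rw [hBij 1 0 (by simp) (by simp), hA.1.apply, h01, hBij 1 3 (by simp) (by simp)]
      simp [hB, edgeMatrix_self_left, hc]
      ring
    have hBu : ∀ i, 0 < u i → i ≠ 1 → i ≠ 2 → (B *ᵥ u) i = 0 := by
      intro i hi hi1 hi2
      rw [← hA.mulVec_zero_eq_zero hu h0 hi]
      simp only [Matrix.mulVec, dotProduct, Fin.sum_univ_five, hu1, hu2, mul_zero]
      rw [hBij i 0 (by simp) (by simp), hBij i 3 (by simp) (by simp),
        hBij i 4 (by simp [hi1.symm]) (by simp)]
    have hcross : z ⬝ᵥ (B *ᵥ u) = 0 := by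
      simp only [dotProduct, Fin.sum_univ_five]
      rw [hz1, hz2, hz4, hBu 0 hu0 (by simp) (by simp), hBu 3 hu3 (by simp) (by simp)]
      ring
    rw [hx, form_add hBs, form_smul, Matrix.mulVec_smul, dotProduct_smul, hcross, huu, hform, hz4]
    simp only [smul_zero, mul_zero, sub_zero, add_zero]
    refine form_nonneg_of_nonpos_offDiag hA fun i j => ?_
    revert i j
    have h10 := hA.1.apply 0 1
    have h30 := hA.1.apply 0 3
    have h31 := hA.1.apply 1 3
    refine fin_five_cases (fin_five_cases ?_ ?_ ?_ ?_ ?_) (fin_five_cases ?_ ?_ ?_ ?_ ?_)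
      (fun j _ => Or.inr (Or.inl hz2)) (fin_five_cases ?_ ?_ ?_ ?_ ?_)
      (fun j _ => Or.inr (Or.inl hz4)) <;>
      simp [hz2, hz4, h01, h03, h13, h10, h30, h31]
  have hBc : CopositiveMatrix B := by
    refine ⟨hBs, fun x hx => ?_⟩
    -- For `x 3 ≤ t * x 4` coordinate 1 contributes nonnegatively and can be deleted; in the
    -- opposite case coordinate 2 can.
    rcases le_total (x 3) (t * x 4) with h | h
    · have h1 := hA.2 ![x 0, 0, x 2, x 3, x 4] (fin_five_cases (hx 0) le_rfl (hx 2) (hx 3) (hx 4))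
      rw [hform]
      rw [form_fin_five hA.1] at h1 ⊢
      simp only [Matrix.cons_val] at h1
      have h5 := mul_nonneg (hA.diag_nonneg 1) (sq_nonneg (x 1))
      have h6 : 0 ≤ -A 1 3 * (x 1 * (t * x 4 - x 3)) :=
        mul_nonneg (by linarith) (mul_nonneg (hx 1) (by linarith))
      rw [hc, h01, h12]
      rw [h02] at h1 ⊢
      linarith
    · have h1 := hface ![x 0, x 1, 0, x 3, x 4] rfl
      rw [hform, form_fin_five hA.1] at h1 ⊢
      simp only [Matrix.cons_val] at h1
      have h5 := mul_nonneg (hA.diag_nonneg 2) (sq_nonneg (x 2))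
      have h6 : 0 ≤ A 2 3 * (x 2 * (x 3 - t * x 4)) :=
        mul_nonneg h23 (mul_nonneg (hx 2) (by linarith))
      have h7 : 0 ≤ (A 2 4 + A 2 3 * t) * (x 2 * x 4) :=
        mul_nonneg hr2' (mul_nonneg (hx 2) (hx 4))
      rw [h02, h12]
      linarith
  exact (hBc.spn_of_form_nonneg 2 hface).mono hBs hA.1 (sub_smul_edgeMatrix_le hr1' 1 4)

theorem StrictlyCopositive.spn_of_book_signs (hA : StrictlyCopositive A) (h01 : A 0 1 = 0)
    (h02 : A 0 2 = 0) (h12 : A 1 2 = 0) (h03 : A 0 3 < 0) (h04 : 0 < A 0 4) (h13 : A 1 3 < 0) :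
    SPNMatrix A := by
  by_contra hn
  have hz : ∀ j : Fin 5, j ≠ 0 → j ≠ 3 → j ≠ 4 → A 0 j = 0 :=
    fin_five_cases (by simp) (by simp [h01]) (by simp [h02]) (by simp) (by simp)
  obtain ⟨c, hc0, hc, hcop, u, hu, h0, huv, hud, hue, hsupp, hneg⟩ :=
    hA.exists_triangle_zero (by simp) hn (by simp) (by simp) (by simp) hz h03 h04
  rcases le_total (A 2 3) 0 with h23 | h23
  · refine hn (hA.spn_of_row_nonpos (by simp) 3 (fin_five_cases ?_ ?_ ?_ ?_ ?_))
    · rw [hA.1.apply]; exact fun _ => h03.le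
    · rw [hA.1.apply]; exact fun _ => h13.le
    · rw [hA.1.apply]; exact fun _ => h23
    · simp
    · rw [hA.1.apply]; exact fun _ => hneg.le
  · refine hn ((hcop.spn_of_book_zero ?_ ?_ ?_ ?_ ?_ ?_ hu h0 huv
      (hsupp 1 (by simp) (by simp) (by simp)) (hsupp 2 (by simp) (by simp) (by simp)) hud hue).mono
      hcop.1 hA.1 (sub_smul_edgeMatrix_le hc0.le _ _)) <;>
      simp [edgeMatrix_apply_of_ne, h01, h02, h12, h03.le, h13.le, h23]

end OrderFive

/-! ### Relabelling, and the triangle in the complement. -/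

theorem spn_of_spn_submatrix_equiv {V W : Type*} {A : Matrix V V ℝ} (f : W ≃ V) (h : SPNMatrix (A.submatrix f f)) :
    SPNMatrix A := by
  simpa using h.submatrix f.symm

section Relabel
variable {V W : Type*} [Fintype V] [Fintype W] {A : Matrix V V ℝ}

theorem StrictlyCopositive.submatrix_equiv (hA : StrictlyCopositive A) (f : W ≃ V) :
    StrictlyCopositive (A.submatrix f f) := by
  refine ⟨hA.1.submatrix f, fun x hx hx0 => ?_⟩
  rw [form_submatrix_equiv]
  refine hA.2 _ (fun i => hx _) fun h => hx0 ?_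
  ext i
  simpa using congrFun h (f i)

theorem CopositiveMatrix.submatrix_equiv (hA : CopositiveMatrix A) (f : W ≃ V) :
    CopositiveMatrix (A.submatrix f f) := by
  refine ⟨hA.1.submatrix f, fun x hx => ?_⟩
  rw [form_submatrix_equiv]
  exact hA.2 _ fun i => hx _

/-- The complement contains a triangle. -/
theorem StrictlyCopositive.spn_of_triangle {A : Matrix (Fin 5) (Fin 5) ℝ}
    (hA : StrictlyCopositive A) (h01 : A 0 1 = 0) (h02 : A 0 2 = 0) (h12 : A 1 2 = 0) :
    SPNMatrix A := by
  by_contra hn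
  have h10 := hA.1.apply 0 1
  have h20 := hA.1.apply 0 2
  have h21 := hA.1.apply 1 2
  rw [h01] at h10
  rw [h02] at h20
  rw [h12] at h21
  have key : ∀ f : Fin 5 → Fin 5, Function.Bijective f → A (f 0) (f 1) = 0 → A (f 0) (f 2) = 0 →
      A (f 1) (f 2) = 0 → A (f 0) (f 3) < 0 → 0 < A (f 0) (f 4) → A (f 1) (f 3) < 0 → False :=
    fun f hf a b c d e g => hn (spn_of_spn_submatrix_equiv (Equiv.ofBijective f hf)
      ((hA.submatrix_equiv (Equiv.ofBijective f hf)).spn_of_book_signs a b c d e g))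
  have hs := fun v (h : ∀ j, j ≠ v → j ≠ 3 → j ≠ 4 → A v j = 0) =>
    hA.mixed_signs_of_degree_two (by simp) hn h
  -- Each of the vertices 0, 1, 2 is joined to 3 and 4 with opposite signs; by pigeonhole two of
  -- them agree on which sign goes where.
  rcases hs 0 (fin_five_cases (by simp) (by simp [h01]) (by simp [h02]) (by simp) (by simp))
    with ⟨a0, b0⟩ | ⟨a0, b0⟩ <;>
  rcases hs 1 (fin_five_cases (by simp [h10]) (by simp) (by simp [h12]) (by simp) (by simp))
    with ⟨a1, b1⟩ | ⟨a1, b1⟩ <;>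
  rcases hs 2 (fin_five_cases (by simp [h20]) (by simp [h21]) (by simp) (by simp) (by simp))
    with ⟨a2, b2⟩ | ⟨a2, b2⟩
  · exact key ![0, 1, 2, 3, 4] (by decide) h01 h02 h12 a0 b0 a1
  · exact key ![0, 1, 2, 3, 4] (by decide) h01 h02 h12 a0 b0 a1
  · exact key ![0, 2, 1, 3, 4] (by decide) h02 h01 h21 a0 b0 a2
  · exact key ![1, 2, 0, 4, 3] (by decide) h12 h10 h20 a1 b1 a2
  · exact key ![1, 2, 0, 3, 4] (by decide) h12 h10 h20 a1 b1 a2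
  · exact key ![0, 2, 1, 4, 3] (by decide) h02 h01 h21 a0 b0 a2
  · exact key ![0, 1, 2, 4, 3] (by decide) h01 h02 h12 a0 b0 a1
  · exact key ![0, 1, 2, 4, 3] (by decide) h01 h02 h12 a0 b0 a1

end Relabel

/-! ### Combinatorics of the complement. -/

section Labelings

/-- A symmetric relation on five points containing no star with three leaves, no triangle, no
disjoint union of a path of length two and an edge, and no cycle of length four, is contained in a
path of length three, so that its complement contains the fan. -/
theorem exists_fan_labeling {V : Type*} [Fintype V] (hV : Fintype.card V = 5) {r : V → V → Prop}
    (hr : ∀ a b, r a b → r b a)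
    (star : ∀ f : Fin 5 → V, f.Injective → r (f 0) (f 1) → r (f 0) (f 2) → ¬r (f 0) (f 3))
    (triangle : ∀ f : Fin 5 → V, f.Injective → r (f 0) (f 1) → r (f 0) (f 2) → ¬r (f 1) (f 2))
    (path_edge : ∀ f : Fin 5 → V, f.Injective → r (f 0) (f 1) → r (f 1) (f 2) → ¬r (f 3) (f 4))
    (cycle : ∀ f : Fin 5 → V, f.Injective → r (f 0) (f 1) → r (f 1) (f 2) → r (f 2) (f 3) →
      ¬r (f 0) (f 3)) :
    ∃ f : Fin 5 → V, f.Injective ∧ ¬r (f 0) (f 1) ∧ ¬r (f 1) (f 3) ∧ ¬r (f 3) (f 4) ∧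
      ¬r (f 2) (f 0) ∧ ¬r (f 2) (f 1) ∧ ¬r (f 2) (f 3) ∧ ¬r (f 2) (f 4) := by
  by_contra hcon
  have key : ∀ f : Fin 5 → V, f.Injective → ¬r (f 0) (f 1) → ¬r (f 1) (f 3) → ¬r (f 3) (f 4) →
      ¬r (f 2) (f 0) → ¬r (f 2) (f 1) → ¬r (f 2) (f 3) → ¬r (f 2) (f 4) → False :=
    fun f hf a b c d e g h => hcon ⟨f, hf, a, b, c, d, e, g, h⟩
  -- Configurations are excluded from the largest down: path of length three, path of length two,
  -- two disjoint edges, one edge. With the larger ones gone, each lies inside the complement of a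
  -- suitably labelled fan, contradicting `key`.
  have two_edges : ∀ f : Fin 5 → V, f.Injective → r (f 0) (f 1) → ¬r (f 1) (f 2) := by
    intro f hf h01 h12
    have h10 := hr _ _ h01
    have three_edges : ∀ f : Fin 5 → V, f.Injective → r (f 0) (f 1) → r (f 1) (f 2) →
        ¬r (f 0) (f 3) := by
      intro f hf h01 h12 h03
      have h10 := hr _ _ h01
      have h21 := hr _ _ h12
      have h30 := hr _ _ h03
      refine key (f ∘ ![0, 2, 4, 3, 1]) (hf.comp (by decide)) (fun h => ?_) (fun h => ?_)
        (fun h => ?_) (fun h => ?_) (fun h => ?_) (fun h => ?_) (fun h => ?_)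
      · exact triangle f hf h01 h h12
      · exact cycle f hf h01 h12 h h03
      · exact triangle (f ∘ ![0, 1, 3, 2, 4]) (hf.comp (by decide)) h01 h03 (hr _ _ h)
      · exact star (f ∘ ![0, 1, 3, 4, 2]) (hf.comp (by decide)) h01 h03 (hr _ _ h)
      · exact path_edge (f ∘ ![3, 0, 1, 2, 4]) (hf.comp (by decide)) h30 h01 (hr _ _ h)
      · exact path_edge (f ∘ ![0, 1, 2, 3, 4]) (hf.comp (by decide)) h01 h12 (hr _ _ h)
      · exact star (f ∘ ![1, 0, 2, 4, 3]) (hf.comp (by decide)) h10 h12 (hr _ _ h)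
    have h21 := hr _ _ h12
    refine key (f ∘ ![1, 3, 4, 0, 2]) (hf.comp (by decide)) (fun h => ?_) (fun h => ?_)
      (fun h => ?_) (fun h => ?_) (fun h => ?_) (fun h => ?_) (fun h => ?_)
    · exact star (f ∘ ![1, 0, 2, 3, 4]) (hf.comp (by decide)) h10 h12 h
    · exact three_edges f hf h01 h12 (hr _ _ h)
    · exact triangle f hf h01 h h12
    · exact star (f ∘ ![1, 0, 2, 4, 3]) (hf.comp (by decide)) h10 h12 (hr _ _ h)
    · exact path_edge f hf h01 h12 (hr _ _ h)
    · exact three_edges (f ∘ ![0, 1, 2, 4, 3]) (hf.comp (by decide)) h01 h12 (hr _ _ h)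
    · exact three_edges (f ∘ ![2, 1, 0, 4, 3]) (hf.comp (by decide)) h21 h10 (hr _ _ h)
  have matching : ∀ f : Fin 5 → V, f.Injective → r (f 0) (f 1) → r (f 2) (f 3) → False := by
    intro f hf h01 h23
    have h10 := hr _ _ h01
    have h32 := hr _ _ h23
    refine key (f ∘ ![1, 3, 4, 0, 2]) (hf.comp (by decide)) (fun h => ?_) (fun h => ?_)
      (fun h => ?_) (fun h => ?_) (fun h => ?_) (fun h => ?_) (fun h => ?_)
    · exact two_edges (f ∘ ![0, 1, 3, 2, 4]) (hf.comp (by decide)) h01 h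
    · exact two_edges (f ∘ ![1, 0, 3, 2, 4]) (hf.comp (by decide)) h10 (hr _ _ h)
    · exact two_edges (f ∘ ![1, 0, 2, 3, 4]) (hf.comp (by decide)) h10 h
    · exact two_edges (f ∘ ![0, 1, 4, 2, 3]) (hf.comp (by decide)) h01 (hr _ _ h)
    · exact two_edges (f ∘ ![2, 3, 4, 0, 1]) (hf.comp (by decide)) h23 (hr _ _ h)
    · exact two_edges (f ∘ ![1, 0, 4, 2, 3]) (hf.comp (by decide)) h10 (hr _ _ h)
    · exact two_edges (f ∘ ![3, 2, 4, 0, 1]) (hf.comp (by decide)) h32 (hr _ _ h)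
  have no_edge : ∀ f : Fin 5 → V, f.Injective → ¬r (f 0) (f 1) := by
    intro f hf h01
    have h10 := hr _ _ h01
    refine key (f ∘ ![1, 3, 4, 0, 2]) (hf.comp (by decide)) (fun h => ?_) (fun h => ?_)
      (fun h => ?_) (fun h => ?_) (fun h => ?_) (fun h => ?_) (fun h => ?_)
    · exact two_edges (f ∘ ![0, 1, 3, 2, 4]) (hf.comp (by decide)) h01 h
    · exact two_edges (f ∘ ![1, 0, 3, 2, 4]) (hf.comp (by decide)) h10 (hr _ _ h)
    · exact two_edges (f ∘ ![1, 0, 2, 3, 4]) (hf.comp (by decide)) h10 h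
    · exact two_edges (f ∘ ![0, 1, 4, 2, 3]) (hf.comp (by decide)) h01 (hr _ _ h)
    · exact matching (f ∘ ![0, 1, 4, 3, 2]) (hf.comp (by decide)) h01 h
    · exact two_edges (f ∘ ![1, 0, 4, 2, 3]) (hf.comp (by decide)) h10 (hr _ _ h)
    · exact matching (f ∘ ![0, 1, 4, 2, 3]) (hf.comp (by decide)) h01 h
  set f : Fin 5 → V := fun i => (Fintype.equivFinOfCardEq hV).symm i
  have hf : f.Injective := Equiv.injective _
  exact key f hf (no_edge f hf) (no_edge (f ∘ ![1, 3, 0, 2, 4]) (hf.comp (by decide)))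
    (no_edge (f ∘ ![3, 4, 0, 1, 2]) (hf.comp (by decide)))
    (no_edge (f ∘ ![2, 0, 1, 3, 4]) (hf.comp (by decide)))
    (no_edge (f ∘ ![2, 1, 0, 3, 4]) (hf.comp (by decide)))
    (no_edge (f ∘ ![2, 3, 0, 1, 4]) (hf.comp (by decide)))
    (no_edge (f ∘ ![2, 4, 0, 1, 3]) (hf.comp (by decide)))

end Labelings

/-! ### The counterexample on the fan. -/

section FanMatrix

/-- A copositive matrix with graph `fanF5` that is not SPN. -/
def fanMatrix : Matrix (Fin 5) (Fin 5) ℝ :=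
  !![24, -24, 24, 0, 0;
    -24, 27, -30, 23, 0;
    24, -30, 36, -30, 24;
    0, 23, -30, 27, -24;
    0, 0, 24, -24, 24]

theorem fanMatrix_isSymm : fanMatrix.IsSymm := by
  ext i j
  fin_cases i <;> fin_cases j <;> rfl

theorem fanMatrix_form (x : Fin 5 → ℝ) : x ⬝ᵥ (fanMatrix *ᵥ x) =
    24 * x 0 ^ 2 + 27 * x 1 ^ 2 + 36 * x 2 ^ 2 + 27 * x 3 ^ 2 + 24 * x 4 ^ 2 +
    2 * (-24 * (x 0 * x 1) + 24 * (x 0 * x 2) - 30 * (x 1 * x 2) + 23 * (x 1 * x 3) -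
      30 * (x 2 * x 3) + 24 * (x 2 * x 4) - 24 * (x 3 * x 4)) := by
  rw [form_fin_five fanMatrix_isSymm]
  simp [fanMatrix]
  ring

/-- The form left on the three inner vertices when one end vertex is minimized out, contributing
`-24 (a - b)²`. It equals `3 (a - 2b + 7c/3)² + 32 c (a - b) + (32/3) c²`. -/
theorem fan_minor_form_nonneg {a b c : ℝ} (hc : 0 ≤ c) (hab : b ≤ a) :
    0 ≤ 27 * a ^ 2 + 36 * b ^ 2 + 27 * c ^ 2 + 46 * (a * c) - 60 * (a * b) - 60 * (b * c) -
      24 * (a - b) ^ 2 := by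
  nlinarith [sq_nonneg (a - 2 * b + 7 / 3 * c), mul_nonneg hc (sub_nonneg.2 hab), sq_nonneg c]

theorem fanMatrix_copositive : CopositiveMatrix fanMatrix := by
  refine ⟨fanMatrix_isSymm, fun x hx => ?_⟩
  rw [fanMatrix_form]
  have h0 := hx 0
  have h1 := hx 1
  have h2 := hx 2
  have h3 := hx 3
  have h4 := hx 4
  generalize x 0 = a at *
  generalize x 1 = b at *
  generalize x 2 = c at *
  generalize x 3 = d at *
  generalize x 4 = e at *
  -- The minimum over `a ≥ 0` is attained at `max (b - c) 0`, and over `e ≥ 0` at `max (d - c) 0`;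
  -- the cases are the signs.
  rcases le_total c b with hbc | hbc <;> rcases le_total c d with hdc | hdc
  · have : 0 ≤ 27 * b ^ 2 + 36 * c ^ 2 + 27 * d ^ 2 + 46 * (b * d) - 60 * (b * c) -
        60 * (c * d) - 24 * (b - c) ^ 2 - 24 * (d - c) ^ 2 := by
      nlinarith [mul_nonneg (sub_nonneg.2 hbc) (sub_nonneg.2 hdc), mul_nonneg h2 (sub_nonneg.2 hbc),
        mul_nonneg h2 (sub_nonneg.2 hdc), sq_nonneg (b - c), sq_nonneg (d - c), sq_nonneg c]
    nlinarith [sq_nonneg (a - (b - c)), sq_nonneg (e - (d - c))]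
  · have := fan_minor_form_nonneg h3 hbc
    nlinarith [sq_nonneg (a - (b - c)), mul_nonneg h4 (sub_nonneg.2 hdc), sq_nonneg e]
  · have := fan_minor_form_nonneg h1 hdc
    nlinarith [sq_nonneg (e - (d - c)), mul_nonneg h0 (sub_nonneg.2 hbc), sq_nonneg a]
  · have : 27 * b ^ 2 + 36 * c ^ 2 + 27 * d ^ 2 + 46 * (b * d) - 60 * (b * c) - 60 * (c * d) =
        (5 * (b + d) - 6 * c) ^ 2 + 2 * (b - d) ^ 2 := by ring
    nlinarith [sq_nonneg (5 * (b + d) - 6 * c), sq_nonneg (b - d), sq_nonneg a, sq_nonneg e,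
      mul_nonneg h0 (sub_nonneg.2 hbc), mul_nonneg h4 (sub_nonneg.2 hdc)]

/-- If `P + N` is a decomposition of `A` into a positive semidefinite and a nonnegative matrix, then
`P` annihilates the nonnegative zeros of the form of `A`, on whose support `N` vanishes. -/
theorem decomposition_at_zero {V : Type*} [Fintype V] {A P N : Matrix V V ℝ} (hP : P.PosSemidef)
    (hN : ∀ i j, 0 ≤ N i j) (hA : A = P + N) {u : V → ℝ} (hu : ∀ i, 0 ≤ u i)
    (h0 : u ⬝ᵥ (A *ᵥ u) = 0) : P *ᵥ u = 0 ∧ ∀ i j, 0 < u i → 0 < u j → N i j = 0 := by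
  have hrow : ∀ i, 0 ≤ (N *ᵥ u) i := fun i =>
    Finset.sum_nonneg fun j _ => mul_nonneg (hN i j) (hu j)
  have h1 := form_nonneg_of_posSemidef hP u
  have h2 : 0 ≤ u ⬝ᵥ (N *ᵥ u) := Finset.sum_nonneg fun i _ => mul_nonneg (hu i) (hrow i)
  rw [hA, Matrix.add_mulVec, dotProduct_add] at h0
  refine ⟨(hP.dotProduct_mulVec_zero_iff u).1 ?_, fun i j hi hj => ?_⟩
  · rw [star_trivial]; linarith
  · have h3 : u ⬝ᵥ (N *ᵥ u) = 0 := by linarith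
    have h4 := (Finset.sum_eq_zero_iff_of_nonneg fun i _ => mul_nonneg (hu i) (hrow i)).1 h3 i
      (Finset.mem_univ i)
    have h5 : (N *ᵥ u) i = 0 := (mul_eq_zero.1 h4).resolve_left hi.ne'
    have h6 := (Finset.sum_eq_zero_iff_of_nonneg fun j _ => mul_nonneg (hN i j) (hu j)).1 h5 j
      (Finset.mem_univ j)
    exact (mul_eq_zero.1 h6).resolve_right hj.ne'

theorem not_spn_fanMatrix : ¬SPNMatrix fanMatrix := by
  rintro ⟨P, N, hP, -, hN, h⟩
  have hs := isSymm_of_posSemidef hP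
  have hentry : ∀ i j, fanMatrix i j = P i j + N i j := fun i j => by rw [h, Matrix.add_apply]
  -- The zeros pin `P 1 2 = -30`, `P 1 3 = 23`, `P 2 4 = 24`. The kernel equations then give `P 1 4
  -- = -16` and `P 0 4 = 8`, so `N 0 4 = -8`.
  obtain ⟨hk1, hz1⟩ := decomposition_at_zero hP hN h (u := ![1, 2, 1, 0, 0])
    (fin_five_cases (by simp) (by simp) (by simp) (by simp) (by simp))
    (by rw [fanMatrix_form]; simp; norm_num)
  obtain ⟨hk2, hz2⟩ := decomposition_at_zero hP hN h (u := ![0, 0, 1, 2, 1])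
    (fin_five_cases (by simp) (by simp) (by simp) (by simp) (by simp))
    (by rw [fanMatrix_form]; simp; norm_num)
  obtain ⟨-, hz3⟩ := decomposition_at_zero hP hN h (u := ![0, 3, 5, 3, 0])
    (fin_five_cases (by simp) (by simp) (by simp) (by simp) (by simp))
    (by rw [fanMatrix_form]; simp; norm_num)
  have e12 := hentry 1 2
  have e13 := hentry 1 3
  have e24 := hentry 2 4
  have e04 := hentry 0 4
  rw [hz3 1 2 (by simp) (by simp)] at e12
  rw [hz3 1 3 (by simp) (by simp)] at e13
  rw [hz2 2 4 (by simp) (by simp)] at e24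
  have hk11 := congrFun hk1 4
  have hk21 := congrFun hk2 1
  simp only [Matrix.mulVec, dotProduct, Fin.sum_univ_five, Matrix.cons_val, Pi.zero_apply,
    hs.apply 0 4, hs.apply 1 4, hs.apply 2 4] at hk11 hk21
  simp only [fanMatrix, Matrix.of_apply, Matrix.cons_val] at e12 e13 e24 e04
  linarith [hN 0 4]

theorem fanF5_adj_of_fanMatrix_ne_zero : ∀ i j, i ≠ j → fanMatrix i j ≠ 0 → fanF5.Adj i j := by
  refine fin_five_cases ?_ ?_ ?_ ?_ ?_ <;> refine fin_five_cases ?_ ?_ ?_ ?_ ?_ <;>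
    simp [fanMatrix, fanF5, SimpleGraph.fromEdgeSet_adj]

end FanMatrix

/-! ### The two implications and the theorem. -/

theorem not_spnGraph_of_fanF5_isContained {V : Type*} [Fintype V] (hV : Fintype.card V = 5)
    {G : SimpleGraph V} (hG : fanF5.IsContained G) : ¬SPNGraph G := by
  classical
  intro hspn
  obtain ⟨φ⟩ := hG
  have hbij : Function.Bijective φ := (Fintype.bijective_iff_injective_and_card _).2
    ⟨φ.injective, by simp [hV]⟩
  set f : Fin 5 ≃ V := Equiv.ofBijective φ hbij with hf
  set M := fanMatrix.submatrix f.symm f.symm with hM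
  have hMs : M.IsSymm := fanMatrix_isSymm.submatrix _
  have hMc : CopositiveMatrix M := fanMatrix_copositive.submatrix_equiv f.symm
  have hMG : ∀ i j, i ≠ j → M i j ≠ 0 → G.Adj i j := by
    intro i j hij hne
    have h1 := φ.toHom.map_adj (fanF5_adj_of_fanMatrix_ne_zero (f.symm i) (f.symm j)
      (fun h => hij (f.symm.injective h)) hne)
    have h2 : ∀ i, φ.toHom (f.symm i) = i := fun i => f.apply_symm_apply i
    rwa [h2, h2] at h1
  -- `D` marks the edges of `G` missing from the graph of `M`, so `M + ε • D` has graph exactly `G`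
  -- for every `ε > 0`.
  set D : Matrix V V ℝ := Matrix.of fun i j => if M i j = 0 ∧ G.Adj i j then 1 else 0 with hD
  have hD0 : ∀ i j, 0 ≤ D i j := fun i j => by
    simp only [hD, Matrix.of_apply]
    split_ifs <;> norm_num
  have hDs : D.IsSymm := by
    ext i j
    simp only [hD, Matrix.transpose_apply, Matrix.of_apply, hMs.apply i j, G.adj_comm j i]
  have hMspn : SPNMatrix M := by
    refine spn_of_forall_add_smul hMs (D := D) fun ε hε => ?_
    have hs : (M + ε • D).IsSymm := hMs.add (hDs.smul ε)
    refine hspn _ (hMc.mono hs fun i j => ?_) ?_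
    · simpa using mul_nonneg hε.le (hD0 i j)
    · ext i j
      rw [matrixGraph_adj hs]
      simp only [hD, Matrix.add_apply, Matrix.smul_apply, Matrix.of_apply, smul_eq_mul]
      by_cases hM0 : M i j = 0
      · by_cases hadj : G.Adj i j
        · simp [hM0, hadj, hadj.ne, hε.ne']
        · simp [hM0, hadj]
      · have := hMG i j
        have : G.Adj i j → i ≠ j := fun h => h.ne
        simp only [hM0, false_and, if_false, mul_zero, add_zero]
        tauto
  exact not_spn_fanMatrix (spn_of_spn_submatrix_equiv f.symm hMspn)

theorem StrictlyCopositive.spn_of_not_fanF5_isContained {V : Type*} [Fintype V]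
    (hV : Fintype.card V = 5) {A : Matrix V V ℝ} (hA : StrictlyCopositive A)
    (h : ¬fanF5.IsContained (matrixGraph A)) : SPNMatrix A := by
  by_contra hn
  have hbij : ∀ f : Fin 5 → V, f.Injective → Function.Bijective f := fun f hf =>
    (Fintype.bijective_iff_injective_and_card f).2 ⟨hf, by simp [hV]⟩
  have hsub : ∀ (f : Fin 5 → V), f.Injective → StrictlyCopositive (A.submatrix f f) :=
    fun f hf => hA.submatrix_equiv (Equiv.ofBijective f (hbij f hf))
  have hspn : ∀ (f : Fin 5 → V), f.Injective → ¬SPNMatrix (A.submatrix f f) := fun f hf hs =>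
    hn (spn_of_spn_submatrix_equiv (Equiv.ofBijective f (hbij f hf)) hs)
  obtain ⟨f, hf, h01, h13, h34, h20, h21, h23, h24⟩ := exists_fan_labeling hV
    (r := fun i j => A i j = 0) (fun a b hab => by rwa [hA.1.apply])
    (fun f hf a b c => hspn f hf ((hsub f hf).spn_of_star a b c))
    (fun f hf a b c => hspn f hf ((hsub f hf).spn_of_triangle a b c))
    (fun f hf a b c => hspn f hf ((hsub f hf).spn_of_path_edge a b c))
    (fun f hf a b c d => hspn f hf ((hsub f hf).spn_of_cycle a b c d))
  refine h ⟨⟨⟨f, fun {i j} hij => ?_⟩, hf⟩⟩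
  rw [matrixGraph_adj hA.1]
  refine ⟨hf.ne hij.ne, ?_⟩
  rw [fanF5, SimpleGraph.fromEdgeSet_adj] at hij
  simp only [Set.mem_insert_iff, Set.mem_singleton_iff, Sym2.eq_iff] at hij
  rcases hij.1 with h | h | h | h | h | h | h <;> rcases h with ⟨rfl, rfl⟩ | ⟨rfl, rfl⟩ <;>
    first | assumption | (rw [hA.1.apply]; assumption)

theorem mainTheorem5 {V : Type*} [Fintype V] (hV : Fintype.card V = 5) (G : SimpleGraph V) :
    SPNGraph G ↔ ¬ fanF5.IsContained G := by
  classical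
  refine ⟨fun h hG => not_spnGraph_of_fanF5_isContained hV hG h, fun h A hA hAG => ?_⟩
  refine spn_of_strictlyCopositive_add hA fun ε _ hs => hs.spn_of_not_fanF5_isContained hV ?_
  have : matrixGraph (A + ε • (1 : Matrix V V ℝ)) = matrixGraph A := by
    ext i j
    rw [matrixGraph_adj hs.1, matrixGraph_adj hA.1]
    refine and_congr_right fun hij => ?_
    simp [hij]
  rwa [this, hAG]
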